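/- Let $\Sigma$ be a finite, linearly ordered alphabet, $\lambda$ the empty word. For $L\subseteq\Sigma^*$ and $x\in\Sigma^*$ put $D_L(x)=\{(l,r)\in(\Sigma^*)^2 : lxr\in L\}$. For a relation $\sim$ on $\Sigma^*$, $L$ is \emph{$\sim$-substitutable} if for all $x,y\in\Sigma^*$ with $x\sim y$ and $D_L(x)\cap D_L(y)\neq\emptyset$ one has $D_L(x)=D_L(y)$. The relation $\sim$ is \emph{recognizable} if there are a finite monoid $M$, a homomorphism $h:\Sigma^*\to M$ and $F\subseteq M^2$ with $x\sim y\iff (h(x),h(y))\in F$. Let $\mathcal C_\sim$ be the class of context-free $\sim$-substitutable languages over $\Sigma$. For a finite $K\subseteq\Sigma^*$, $\hat G(K)$ is the context-free grammar with start symbol $\hat S$, nonterminals $\hat S$ and $[x]$ for every nonempty factor $x$ of a word of $K$, and the rules (between existing nonterminals) $[xy]\to[x][y]$; $[x]\to[x']$ whenever $x\sim x'$ and $D_K(x)\cap D_K(x')\ne\emptyset$; $[a]\to a$ for $a\in\Sigma$; and $\hat S\to[w]$ for $w\in K$ (read as $\hat S\to\lambda$ if $w=\lambda$). The size $|G|$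 of a context-free grammar $G$ is $\sum_{A\to\beta}(|\beta|+1)$ over its rules. A finite set $S\subseteq L$ is \emph{characteristic} for $L$ if $\mathcal L(\hat G(K))=L$ for every finite $K$ with $S\subseteq K\subseteq L$. Words are ordered length-lexicographically. $\omega(\beta)$ is the least terminal word derivable from $\beta$; $\chi(A)$ is the least context $(x,z)$ with $S\Rightarrow^*xAz$ (compare $xz$, then $x$). ${\rm CS}(G)$ is the set of all words $x\,\omega(\beta)\,z$ with $A\to\beta$ a rule of $G$ and $(x,z)=\chi(A)$, over those rules for which $\omega(\beta)$ and $\chi(A)$ exist. The thickness $\tau(G)$ is the maximum of $|\omega(\beta)|$ over the rules $A\to\beta$ for which $\omega(\beta)$ exists ($0$ if there are none). $G$ is in \emph{typed normal form} if its start symbol $S$ occurs in no right-hand side, its rules are of the forms $A\to BC$, $A\to a$, $S\to B$, $S\to\lambda$, and any two terminal words derivable from the same nonterminal $A\neq S$ are $\sim$-equivalent. \textbf{Proposition.} (A) Let $\sim$ be a relation on $\Sigma^*$ such that $x\sim y$ is decidable in time polynomial in $|x|+|y|$. Then $\hat G(K)$ is computable from $K$ in time polynomial in the total length $\sum_{w\in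 K}|w|$. (B) Let $\sim$ be a recognizable equivalence relation on $\Sigma^*$. Then $\mathcal C_\sim$ is identifiable in the limit from polynomial time and data by $K\mapsto\hat G(K)$: (1) $\hat G(K)$ is computable in time polynomial in $\sum_{w\in K}|w|$, and there is a polynomial $q$ (depending only on $\Sigma$ and $\sim$) such that for every context-free grammar $G$ with $\mathcal L(G)\in\mathcal C_\sim$ there is a characteristic set for $\mathcal L(G)$ with at most $q(|G|)$ elements. (2) For every $L\in\mathcal C_\sim$ and every sequence $w_1,w_2,\dots$ with $\{w_1,w_2,\dots\}=L$ one has $\mathcal L(\hat G(\{w_1,\dots,w_n\}))=L$ for all sufficiently large $n$. The same holds for the hypotheses of the conservative learner, which starts with $\hat G(\emptyset)$ and, upon reading $w_n$, replaces its current grammar by $\hat G(\{w_1,\dots,w_n\})$ exactly when that grammar does not generate $w_n$. (3) There is a polynomial $q$ (depending only on $\Sigma$ and $\sim$) such that for every $G$ in typed normal form with $\mathcal L(G)\in\mathcal C_\sim$ the set ${\rm CS}(G)$ is finite and characteristic for $\mathcal L(G)$, it has at most as many elements as $G$ has rules, and the sum of the lengths of its words is at most $q(|G|+\tau(G))$.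 -/

import Mathlib

namespace SubstLearn

/-! ### Polynomial time: the WHILE language on binary trees, with size-charged cost -/

/-- Binary trees with leaves `nil` and `atom a`, `a` a letter. -/
inductive Tree (α : Type) : Type
  | nil : Tree α
  | atom (a : α) : Tree α
  | node (l r : Tree α) : Tree α
  deriving DecidableEq

/-- Number of nodes of a tree. -/
def Tree.size {α : Type} : Tree α → ℕ
  | .nil => 1
  | .atom _ => 1
  | .node l r => l.size + r.size + 1

/-- Left subtree (`nil` for a leaf). -/
def Tree.left {α : Type} : Tree α → Tree α
  | .node l _ => l
  | _ => .nil

/-- Right subtree (`nil` for a leaf). -/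
def Tree.right {α : Type} : Tree α → Tree α
  | .node _ r => r
  | _ => .nil

/-- A store gives every variable (numbered by `ℕ`) its value. -/
abbrev Store (α : Type) : Type := ℕ → Tree α

/-- Expressions: variables, constants, pairing, projections and the equality test. -/
inductive Expr (α : Type) : Type
  | var (i : ℕ) : Expr α
  | const (t : Tree α) : Expr α
  | cons (e f : Expr α) : Expr α
  | hd (e : Expr α) : Expr α
  | tl (e : Expr α) : Expr α
  | eq (e f : Expr α) : Expr α

/-- Value of an expression. The test `eq` returns `nil` for "false" and a non-`nil` tree
for "true". -/
def Expr.eval {α : Type} [DecidableEq α] (s : Store α) : Expr α → Tree α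
  | .var i => s i
  | .const t => t
  | .cons e f => .node (e.eval s) (f.eval s)
  | .hd e => (e.eval s).left
  | .tl e => (e.eval s).right
  | .eq e f => if e.eval s = f.eval s then .node .nil .nil else .nil

/-- Cost of evaluating an expression: the total size of the values of all its subexpressions.
So reading, copying, comparing or building a value costs its full size, as on a Turing machine. -/
def Expr.cost {α : Type} [DecidableEq α] (s : Store α) : Expr α → ℕ
  | .var i => (s i).size
  | .const t => t.size
  | .cons e f => e.cost s + f.cost s + ((Expr.cons e f).eval s).size
  | .hd e => e.cost s + ((Expr.hd e).eval s).size
  | .tl e => e.cost s + ((Expr.tl e).eval s).size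
  | .eq e f => e.cost s + f.cost s + ((Expr.eq e f).eval s).size

/-- Commands of the WHILE language. -/
inductive Cmd (α : Type) : Type
  | skip : Cmd α
  | assign (i : ℕ) (e : Expr α) : Cmd α
  | seq (c d : Cmd α) : Cmd α
  | cond (e : Expr α) (c d : Cmd α) : Cmd α
  | loop (e : Expr α) (c : Cmd α) : Cmd α

/-- `Exec c s n s'`: started in the store `s`, the command `c` halts after time `n`
in the store `s'`. -/
inductive Exec {α : Type} [DecidableEq α] : Cmd α → Store α → ℕ → Store α → Prop
  | skip (s : Store α) : Exec .skip s 1 s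
  | assign (s : Store α) (i : ℕ) (e : Expr α) :
      Exec (.assign i e) s (e.cost s + 1) (Function.update s i (e.eval s))
  | seq {c d : Cmd α} {s s' s'' : Store α} {m n : ℕ} (hc : Exec c s m s') (hd : Exec d s' n s'') :
      Exec (.seq c d) s (m + n + 1) s''
  | condTrue {e : Expr α} {c d : Cmd α} {s s' : Store α} {n : ℕ} (he : e.eval s ≠ .nil)
      (hc : Exec c s n s') : Exec (.cond e c d) s (e.cost s + n + 1) s'
  | condFalse {e : Expr α} {c d : Cmd α} {s s' : Store α} {n : ℕ} (he : e.eval s = .nil)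
      (hd : Exec d s n s') : Exec (.cond e c d) s (e.cost s + n + 1) s'
  | loopTrue {e : Expr α} {c : Cmd α} {s s' s'' : Store α} {m n : ℕ} (he : e.eval s ≠ .nil)
      (hc : Exec c s m s') (hl : Exec (.loop e c) s' n s'') :
      Exec (.loop e c) s (e.cost s + m + n + 1) s''
  | loopFalse {e : Expr α} {c : Cmd α} {s : Store α} (he : e.eval s = .nil) :
      Exec (.loop e c) s (e.cost s + 1) s

/-- The initial store: the input in variable `0`, all other variables `nil`. -/
def inputStore {α : Type} (t : Tree α) : Store α := fun i => if i = 0 then t else .nil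

/-- A list as a tree. -/
def encList {α β : Type} (enc : β → Tree α) : List β → Tree α
  | [] => .nil
  | b :: l => .node (enc b) (encList enc l)

/-- A word as the list of its letters. -/
def encWord {α : Type} (w : List α) : Tree α := encList Tree.atom w

/-- The relation `r` on words is decidable in time polynomial in `|x| + |y|`
(the answer, `nil` for "no", is left in variable `0`). -/
def PolyTimeDecidable {α : Type} [DecidableEq α] (r : List α → List α → Prop) : Prop :=
  ∃ (c : Cmd α) (p : Polynomial ℕ), ∀ x y : List α, ∃ (n : ℕ) (s : Store α),
    Exec c (inputStore (.node (encWord x) (encWord y))) n s ∧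
      n ≤ p.eval (x.length + y.length) ∧ (s 0 ≠ .nil ↔ r x y)

/-! ### Substitutable languages -/

/-- The distribution `D_L(x)`: all contexts `(l, r)` with `l x r ∈ L`. -/
def dist {α : Type} (L : Set (List α)) (x : List α) : Set (List α × List α) :=
  {c | c.1 ++ x ++ c.2 ∈ L}

/-- `L` is `∼`-substitutable, where `∼` is the relation `r`. -/
def Substitutable {α : Type} (r : List α → List α → Prop) (L : Language α) : Prop :=
  ∀ x y : List α, (dist L x ∩ dist L y).Nonempty ∧ r x y → dist L x = dist L y

/-- A relation on words is recognizable if it is the preimage, under a homomorphism to a finite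
monoid `M`, of a subset of `M × M`. -/
def Recognizable {α : Type} (r : List α → List α → Prop) : Prop :=
  ∃ (M : Type) (_ : Monoid M) (_ : Finite M) (h : FreeMonoid α →* M) (F : Set (M × M)),
    ∀ x y : List α, r x y ↔ (h (FreeMonoid.ofList x), h (FreeMonoid.ofList y)) ∈ F

/-- The class of context-free `∼`-substitutable languages. -/
def substClass {α : Type} (r : List α → List α → Prop) : Set (Language α) :=
  {L | L.IsContextFree ∧ Substitutable r L}

/-! ### The hypothesis grammars -/

/-- Grammars whose nonterminals are `Ŝ` (written `none`, the start symbol) and `[x]`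
(written `some x`) for words `x`: a finite set of nonterminals and a finite set of rules. -/
structure BracketGrammar (α : Type) where
  nonterminals : Finset (Option (List α))
  rules : Finset (ContextFreeRule α (Option (List α)))

/-- The underlying context-free grammar. -/
def BracketGrammar.toCFG {α : Type} (H : BracketGrammar α) : ContextFreeGrammar α where
  NT := Option (List α)
  initial := none
  rules := H.rules

/-- The generated language. -/
def BracketGrammar.language {α : Type} (H : BracketGrammar α) : Language α := H.toCFG.language

/-- The nonempty words occurring as factors of elements of `K`. -/
def factors {α : Type} [DecidableEq α] (K : Finset (List α)) : Finset (List α) :=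
  K.biUnion fun w => (w.tails.flatMap List.inits).toFinset.erase []

theorem mem_factors {α : Type} [DecidableEq α] (K : Finset (List α)) (x : List α) :
    x ∈ factors K ↔ x ≠ [] ∧ ∃ u v, u ++ x ++ v ∈ K := by
  simp only [factors, Finset.mem_biUnion, Finset.mem_erase, List.mem_toFinset, List.mem_flatMap,
    List.mem_tails, List.mem_inits]
  constructor
  · rintro ⟨w, hw, hx, t, ⟨u, rfl⟩, v, rfl⟩
    exact ⟨hx, u, v, by simpa using hw⟩
  · rintro ⟨hx, u, v, hw⟩
    exact ⟨_, hw, hx, x ++ v, ⟨u, by simp⟩, v, rfl⟩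

/-- The right-hand side `[w]` of a start rule; for the empty word, which has no nonterminal `[w]`,
it is the empty string. -/
def bracket {α : Type} : List α → List (Symbol α (Option (List α)))
  | [] => []
  | a :: w => [.nonterminal (some (a :: w))]

open Classical in
/-- The grammar `Ĝ(K)`. Its rules are
`[xy] → [x][y]`;  `[x] → [y]` if `x ∼ y` and `D_K(x) ∩ D_K(y) ≠ ∅`;  `[a] → a` for letters `a`;
and `Ŝ → [w]` for `w ∈ K`. -/
noncomputable def hatGrammar {α : Type} [DecidableEq α] [Fintype α]
    (r : List α → List α → Prop) (K : Finset (List α)) : BracketGrammar α where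
  nonterminals := insert none ((factors K).image some)
  rules :=
    ((factors K ×ˢ factors K).filter fun p => p.1 ++ p.2 ∈ factors K).image
        (fun p => ⟨some (p.1 ++ p.2), [.nonterminal (some p.1), .nonterminal (some p.2)]⟩) ∪
      ((factors K ×ˢ factors K).filter fun p =>
          r p.1 p.2 ∧ (dist (K : Set (List α)) p.1 ∩ dist (K : Set (List α)) p.2).Nonempty).image
        (fun p => ⟨some p.1, [.nonterminal (some p.2)]⟩) ∪
      ((Finset.univ : Finset α).filter fun a => [a] ∈ factors K).image
        (fun a => ⟨some [a], [.terminal a]⟩) ∪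
      K.image (fun w => ⟨none, bracket w⟩)

/-! ### Identification in the limit from polynomial time and data -/

/-- A symbol as a tree. -/
def encSymbol {α : Type} : Symbol α (Option (List α)) → Tree α
  | .terminal a => .atom a
  | .nonterminal none => .nil
  | .nonterminal (some x) => .node .nil (encWord x)

/-- A rule as a tree. -/
def encRule {α : Type} (ρ : ContextFreeRule α (Option (List α))) : Tree α :=
  .node (encSymbol (.nonterminal ρ.input)) (encList encSymbol ρ.output)

/-- A grammar, with its nonterminals and its rules listed in some order, as a tree. -/
def encGrammar {α : Type} (V : List (Option (List α)))
    (R : List (ContextFreeRule α (Option (List α)))) : Tree α :=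
  .node (encList (fun A => encSymbol (.nonterminal A)) V) (encList encRule R)

/-- The map `K ↦ A K` from finite sets of words to grammars is computable in time polynomial in
the total length of the words in `K`. The input `K` is given by any list of its elements without
repetitions; the output lists all nonterminals and all rules of `A K`. -/
def PolyTimeLearner {α : Type} [DecidableEq α] (A : Finset (List α) → BracketGrammar α) : Prop :=
  ∃ (c : Cmd α) (p : Polynomial ℕ), ∀ (K : Finset (List α)) (l : List (List α)),
    l.Nodup → l.toFinset = K →
      ∃ (n : ℕ) (s : Store α) (V : List (Option (List α)))
        (R : List (ContextFreeRule α (Option (List α)))),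
        Exec c (inputStore (encList encWord l)) n s ∧ n ≤ p.eval (∑ w ∈ K, w.length) ∧
          s 0 = encGrammar V R ∧ (∀ X, X ∈ V ↔ X ∈ (A K).nonterminals) ∧
          ∀ ρ, ρ ∈ R ↔ ρ ∈ (A K).rules

/-- `S` is a characteristic set of `L` for the learner `A`: `S ⊆ L`, and from every finite sample
of `L` that contains `S` the learner returns a grammar of `L`. -/
def IsCharacteristic {α : Type} (A : Finset (List α) → BracketGrammar α) (S : Finset (List α))
    (L : Language α) : Prop :=
  (∀ w ∈ S, w ∈ L) ∧
    ∀ K : Finset (List α), S ⊆ K → (∀ w ∈ K, w ∈ L) → (A K).language = L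

/-- The size of a context-free grammar: the total length of its rules. -/
def grammarSize {α : Type} (G : ContextFreeGrammar α) : ℕ :=
  ∑ ρ ∈ G.rules, (ρ.output.length + 1)

/-- The learner `A` identifies the languages in `C`, represented by context-free grammars, from
polynomial time and data: it runs in polynomial time, and every grammar `G` of a language
in `C` has a characteristic set of cardinality polynomial in the size of `G`. -/
def LearnsFromPolyTimeAndData {α : Type} [DecidableEq α]
    (A : Finset (List α) → BracketGrammar α) (C : Set (Language α)) : Prop :=
  PolyTimeLearner A ∧
    ∃ q : Polynomial ℕ, ∀ G : ContextFreeGrammar α, G.language ∈ C →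
      ∃ S : Finset (List α), S.card ≤ q.eval (grammarSize G) ∧ IsCharacteristic A S G.language

/-- Identification in the limit from positive data. `H w n` is the hypothesis after the first `n`
strings `w 0, …, w (n - 1)` of the presentation `w`. -/
def IdentifiesInLimit {α : Type} (H : (ℕ → List α) → ℕ → BracketGrammar α)
    (C : Set (Language α)) : Prop :=
  ∀ L ∈ C, ∀ w : ℕ → List α, Set.range w = L → ∃ N, ∀ n ≥ N, (H w n).language = L

open Classical in
/-- The set from which the current grammar of the conservative learner was built: it is replaced
by the set of all strings read so far whenever a string is read that the current grammar does
not generate. -/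
noncomputable def conservativeSample {α : Type} [DecidableEq α] [Fintype α]
    (r : List α → List α → Prop) (w : ℕ → List α) : ℕ → Finset (List α)
  | 0 => ∅
  | n + 1 =>
    if w n ∈ (hatGrammar r (conservativeSample r w n)).language then conservativeSample r w n
    else (Finset.range (n + 1)).image w

/-! ### The characteristic set of a grammar in typed normal form -/

/-- The words derived from a sentential form. -/
def yields {α : Type} (G : ContextFreeGrammar α) (β : List (Symbol α G.NT)) : Set (List α) :=
  {w | G.Derives β (w.map Symbol.terminal)}

/-- The contexts `(x, z)` with `S ⇒* x A z`. -/
def contexts {α : Type} (G : ContextFreeGrammar α) (A : G.NT) : Set (List α × List α) :=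
  {c | G.Derives [.nonterminal G.initial]
    (c.1.map Symbol.terminal ++ [.nonterminal A] ++ c.2.map Symbol.terminal)}

/-- `u` is the least element of `W` in the length-lexicographic order. -/
def IsMinWord {α : Type} [LinearOrder α] (W : Set (List α)) (u : List α) : Prop :=
  u ∈ W ∧ ∀ v ∈ W, v = u ∨ List.Shortlex (· < ·) u v

/-- `c` is the least element of `W`, where `(x, z)` precedes `(x', z')` if `xz` precedes `x'z'`, or
`xz = x'z'` and `x` precedes `x'`, in the length-lexicographic order. -/
def IsMinContext {α : Type} [LinearOrder α] (W : Set (List α × List α)) (c : List α × List α) :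
    Prop :=
  c ∈ W ∧ ∀ d ∈ W, d = c ∨ List.Shortlex (· < ·) (c.1 ++ c.2) (d.1 ++ d.2) ∨
    (c.1 ++ c.2 = d.1 ++ d.2 ∧ List.Shortlex (· < ·) c.1 d.1)

/-- `CS(G)`: the words `x ω(β) z` for the rules `A → β`, with `ω(β)` the least word derived
from `β` and `(x, z)` the least context of `A`. -/
def charSet {α : Type} [LinearOrder α] (G : ContextFreeGrammar α) : Set (List α) :=
  {w | ∃ ρ ∈ G.rules, ∃ (u : List α) (c : List α × List α),
    IsMinWord (yields G ρ.output) u ∧ IsMinContext (contexts G ρ.input) c ∧ w = c.1 ++ u ++ c.2}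

/-- The thickness of `G`: the maximum over the rules `A → β` of the length of a shortest word
derived from `β` (rules that derive no word contribute `0`). -/
noncomputable def thickness {α : Type} (G : ContextFreeGrammar α) : ℕ :=
  G.rules.sup fun ρ => sInf (List.length '' yields G ρ.output)

/-- Typed normal form: the start symbol `S` occurs in no right-hand side; the rules are `A → BC`
and `A → a`, and for the start symbol also `S → B` and `S → λ`; and all words derived from one
nonterminal `A ≠ S` are `∼`-equivalent (in particular if they have the same image under a
homomorphism that recognizes the equivalence relation `∼`). -/
def TypedNormalForm {α : Type} (r : List α → List α → Prop) (G : ContextFreeGrammar α) : Prop :=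
  (∀ ρ ∈ G.rules, Symbol.nonterminal G.initial ∉ ρ.output ∧
    ((∃ B C : G.NT, ρ.output = [.nonterminal B, .nonterminal C]) ∨
      (∃ a : α, ρ.output = [.terminal a]) ∨
      (ρ.input = G.initial ∧ (ρ.output = [] ∨ ∃ B : G.NT, ρ.output = [.nonterminal B])))) ∧
  ∀ A : G.NT, A ≠ G.initial →
    ∀ u ∈ yields G [.nonterminal A], ∀ v ∈ yields G [.nonterminal A], r u v

end SubstLearn

namespace SubstLearn

open Function

/-! ### Polynomial-time computable functions -/

/-! Running time. Polynomial-time functions on encoded data are closed under composition, pairing,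
case distinction and those folds whose intermediate values stay polynomially small. The rules of
`Ĝ(K)` are obtained by enumerating all occurrences `(u, x, v)` of nonempty factors in words of `K`,
of which there are polynomially many, and comparing them pairwise (`polyTimeLearner_hatGrammar`).
The relation enters only through a polynomial-time decision function. It comes from the given
program, moved to fresh variables (`PolyTimeDecidable.polyTime`), or from evaluating the
homomorphism letter by letter in a finite monoid (`Recognizable.polyTime`).

Soundness. If `K ⊆ L` and `L` is substitutable, erase the brackets in a sentential form of `Ĝ(K)`:
after the start rule the result is always a word of `L`. Only `[x] → [y]` changes it, and then `x ∼
y` share a context in `K ⊆ L`, so they have the same distribution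
(`Substitutable.hatGrammar_sound`). Hence only completeness depends on the sample.

Completeness. A derivation of `G` is simulated with representatives: a sentential form `γ` is
represented by `[u]` for a chosen `u` derived from `γ`. A unit rule replaces `u` by a concatenation
of representatives of the parts of `γ`, and a branching rule separates them. For this, both words
must occur in `K` in one context and must be equivalent. For an arbitrary grammar, one
representative is chosen for every suffix of a right-hand side and every element of the monoid.
Suffixes make the grammar binary in effect, monoid elements ensure equivalence, and the number of
sample words is cubic in `|G|` (`isCharacteristic_typedSample`). In typed normal form the
nonterminals already determine the equivalence class, so the least words and least contexts suffice
(`TypedNormalForm.isCharacteristic`). These contexts are short, because a path in the derivation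
tree from the start symbol need not repeat a nonterminal and each step adds at most one word of
length at most the thickness (`TypedNormalForm.exists_short_context`).

Limits. Every finite characteristic set is eventually contained in the data. For the conservative
learner, a late update produces a correct grammar, and without late updates the grammar is
consistent with all data and sound (`identifiesInLimit_conservativeSample`). -/

theorem polynomial_eval_mono (p : Polynomial ℕ) {m n : ℕ} (h : m ≤ n) : p.eval m ≤ p.eval n := by
  induction p using Polynomial.induction_on' with
  | add p q hp hq => simpa using Nat.add_le_add hp hq
  | monomial k a => simpa using Nat.mul_le_mul_left a (Nat.pow_le_pow_left h k)

/-- `Runs c s s' N`: started in the store `s`, the command `c` halts in the store `s'` after at most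
`N` time units. -/
def Runs {α : Type} [DecidableEq α] (c : Cmd α) (s s' : Store α) (N : ℕ) : Prop :=
  ∃ n ≤ N, Exec c s n s'

section Runs

variable {α : Type} [DecidableEq α]

theorem Runs.mono {c : Cmd α} {s s' : Store α} {M N : ℕ} (h : Runs c s s' M) (hMN : M ≤ N) :
    Runs c s s' N :=
  let ⟨n, hn, he⟩ := h
  ⟨n, hn.trans hMN, he⟩

theorem Runs.assign (s : Store α) (i : ℕ) (e : Expr α) :
    Runs (.assign i e) s (update s i (e.eval s)) (e.cost s + 1) :=
  ⟨_, le_rfl, .assign s i e⟩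

theorem Runs.seq {c d : Cmd α} {s s' s'' : Store α} {M N : ℕ} (hc : Runs c s s' M)
    (hd : Runs d s' s'' N) : Runs (.seq c d) s s'' (M + N + 1) :=
  let ⟨_, hm, hc⟩ := hc
  let ⟨_, hn, hd⟩ := hd
  ⟨_, by omega, .seq hc hd⟩

theorem Runs.condTrue {e : Expr α} {c d : Cmd α} {s s' : Store α} {N : ℕ} (he : e.eval s ≠ .nil)
    (hc : Runs c s s' N) : Runs (.cond e c d) s s' (e.cost s + N + 1) :=
  let ⟨_, hn, hc⟩ := hc
  ⟨_, by omega, .condTrue he hc⟩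

theorem Runs.condFalse {e : Expr α} {c d : Cmd α} {s s' : Store α} {N : ℕ} (he : e.eval s = .nil)
    (hd : Runs d s s' N) : Runs (.cond e c d) s s' (e.cost s + N + 1) :=
  let ⟨_, hn, hd⟩ := hd
  ⟨_, by omega, .condFalse he hd⟩

theorem Runs.loopTrue {e : Expr α} {c : Cmd α} {s s' s'' : Store α} {M N : ℕ}
    (he : e.eval s ≠ .nil) (hc : Runs c s s' M) (hl : Runs (.loop e c) s' s'' N) :
    Runs (.loop e c) s s'' (e.cost s + M + N + 1) :=
  let ⟨_, hm, hc⟩ := hc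
  let ⟨_, hn, hl⟩ := hl
  ⟨_, by omega, .loopTrue he hc hl⟩

theorem Runs.loopFalse {e : Expr α} {c : Cmd α} {s : Store α} (he : e.eval s = .nil) :
    Runs (.loop e c) s s (e.cost s + 1) :=
  ⟨_, le_rfl, .loopFalse he⟩

end Runs

/-- Types whose elements are encoded as trees. -/
class Enc (α β : Type) where
  enc : β → Tree α

instance (α : Type) : Enc α α := ⟨Tree.atom⟩

instance (α : Type) : Enc α Bool := ⟨fun b => if b then .node .nil .nil else .nil⟩

instance (α β γ : Type) [Enc α β] [Enc α γ] : Enc α (β × γ) :=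
  ⟨fun p => .node (Enc.enc p.1) (Enc.enc p.2)⟩

instance (α β : Type) [Enc α β] : Enc α (List β) := ⟨encList Enc.enc⟩

instance (α : Type) : Enc α (Symbol α (Option (List α))) := ⟨encSymbol⟩

instance (α : Type) : Enc α (Option (List α)) := ⟨fun A => encSymbol (.nonterminal A)⟩

instance (α : Type) : Enc α (ContextFreeRule α (Option (List α))) := ⟨encRule⟩

/-- The size of the encoding of `b`. -/
def esize (α : Type) {β : Type} [Enc α β] (b : β) : ℕ := (Enc.enc b : Tree α).size

/-! ### Sizes of encoded data. -/

section Enc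

variable {α β γ : Type} [Enc α β] [Enc α γ]

theorem Tree.size_pos (t : Tree α) : 0 < t.size := by cases t <;> simp [Tree.size]

theorem esize_pos (b : β) : 0 < esize α b := Tree.size_pos _

@[simp] theorem esize_pair (b : β) (c : γ) : esize α (b, c) = esize α b + esize α c + 1 := rfl

@[simp] theorem esize_nil : esize α ([] : List β) = 1 := rfl

@[simp] theorem esize_cons (b : β) (l : List β) :
    esize α (b :: l) = esize α b + esize α l + 1 := rfl

@[simp] theorem esize_letter (a : α) : esize α a = 1 := rfl

/-- The `+ 1` is the leaf ending the first list, which concatenation removes. -/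
theorem esize_append (l l' : List β) : esize α (l ++ l') + 1 = esize α l + esize α l' := by
  induction l with
  | nil => simp [add_comm]
  | cons b l ih => simp only [List.cons_append, esize_cons]; omega

theorem esize_reverse (l : List β) : esize α l.reverse = esize α l := by
  induction l with
  | nil => rfl
  | cons b l ih =>
    have := esize_append (α := α) l.reverse [b]
    simp at this ⊢
    omega

theorem length_lt_esize (l : List β) : l.length < esize α l := by
  induction l with
  | nil => simp
  | cons b l ih => simp; omega

theorem esize_le_of_mem {l : List β} {b : β} (h : b ∈ l) : esize α b ≤ esize α l := by
  induction l with
  | nil => simp at h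
  | cons c l ih =>
    rcases List.mem_cons.1 h with rfl | h
    · simp; omega
    · have := ih h
      simp; omega

theorem esize_le_of_prefix {l l' : List β} (h : l <+: l') : esize α l ≤ esize α l' := by
  obtain ⟨m, rfl⟩ := h
  have := esize_append (α := α) l m
  have := esize_pos (α := α) m
  omega

theorem esize_le_of_suffix {l l' : List β} (h : l <:+ l') : esize α l ≤ esize α l' := by
  obtain ⟨m, rfl⟩ := h
  have := esize_append (α := α) m l
  have := esize_pos (α := α) m
  omega

theorem esize_le_length_mul {l : List β} {B : ℕ} (h : ∀ b ∈ l, esize α b ≤ B) :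
    esize α l ≤ l.length * (B + 1) + 1 := by
  induction l with
  | nil => simp
  | cons b l ih =>
    have h1 := h b (by simp)
    have h2 := ih fun c hc => h c (by simp [hc])
    simp only [esize_cons, List.length_cons, add_mul, one_mul]
    omega

theorem esize_word (w : List α) : esize α w = 2 * w.length + 1 := by
  induction w with
  | nil => rfl
  | cons a w ih => simp [ih]; omega

theorem esize_bool_le (b : Bool) : esize α b ≤ 3 := by cases b <;> simp [esize, Enc.enc, Tree.size]

end Enc

/-- The function `f` is computable in polynomial time. The program is given for every variable `k`:
it replaces the value of `k` and uses only variables after `k`, which are restored. -/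
def PolyTime (α : Type) [DecidableEq α] {β γ : Type} [Enc α β] [Enc α γ] (f : β → γ) : Prop :=
  ∃ (c : ℕ → Cmd α) (p : Polynomial ℕ), ∀ (k : ℕ) (s : Store α) (b : β), s k = Enc.enc b →
    (∀ j > k, s j = .nil) →
      Runs (c k) s (update s k (Enc.enc (f b))) (p.eval (esize α b)) ∧
        esize α (f b) ≤ p.eval (esize α b)

/-! ### Closure properties of polynomial-time functions. -/

namespace PolyTime

variable {α : Type} [DecidableEq α] {β γ δ ε : Type} [Enc α β] [Enc α γ] [Enc α δ] [Enc α ε]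

theorem esize_le {f : β → γ} (hf : PolyTime α f) :
    ∃ p : Polynomial ℕ, ∀ b, esize α (f b) ≤ p.eval (esize α b) := by
  obtain ⟨c, p, h⟩ := hf
  refine ⟨p, fun b => (h 0 (inputStore (Enc.enc b)) b rfl fun j hj => ?_).2⟩
  simp [inputStore, Nat.pos_iff_ne_zero.1 hj]

/-- Programs see only encodings, so a function with the same encoded values has the same program.
This turns pairs into list cells, rules and nonterminals at no cost. -/
theorem of_enc_eq {f : β → γ} {g : β → δ} (hf : PolyTime α f)
    (h : ∀ b, (Enc.enc (g b) : Tree α) = Enc.enc (f b)) : PolyTime α g := by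
  obtain ⟨c, p, hc⟩ := hf
  refine ⟨c, p, fun k s b hb hs => ?_⟩
  have : esize α (g b) = esize α (f b) := by simp [esize, h]
  rw [h, this]
  exact hc k s b hb hs

theorem of_expr {f : β → γ} (e : ℕ → Expr α) (p : Polynomial ℕ)
    (h : ∀ (k : ℕ) (s : Store α) (b : β), s k = Enc.enc b →
      (e k).eval s = Enc.enc (f b) ∧ (e k).cost s ≤ p.eval (esize α b) ∧
        esize α (f b) ≤ p.eval (esize α b)) : PolyTime α f := by
  refine ⟨fun k => .assign k (e k), p + 1, fun k s b hb hs => ?_⟩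
  obtain ⟨h1, h2, h3⟩ := h k s b hb
  refine ⟨?_, by simp; omega⟩
  rw [← h1]
  exact (Runs.assign s k (e k)).mono (by simpa using h2)

theorem const (c : γ) : PolyTime α fun _ : β => c :=
  of_expr (fun _ => .const (Enc.enc c)) (.C (esize α c)) fun k s b _ => by
    simp [Expr.eval, Expr.cost, esize]

theorem id : PolyTime α fun b : β => b :=
  of_expr (fun k => .var k) .X fun k s b h => by simp [Expr.eval, Expr.cost, esize, h]

theorem fst : PolyTime α (Prod.fst : β × γ → β) :=
  of_expr (fun k => .hd (.var k)) (2 * .X) fun k s b h => by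
    obtain ⟨b, c⟩ := b
    have h : s k = .node (Enc.enc b) (Enc.enc c) := h
    have hsize : (Enc.enc (b, c) : Tree α).size =
        (Enc.enc b : Tree α).size + (Enc.enc c : Tree α).size + 1 := rfl
    simp [Expr.eval, Expr.cost, h, Tree.left, Tree.size, esize]
    omega

theorem snd : PolyTime α (Prod.snd : β × γ → γ) :=
  of_expr (fun k => .tl (.var k)) (2 * .X) fun k s b h => by
    obtain ⟨b, c⟩ := b
    have h : s k = .node (Enc.enc b) (Enc.enc c) := h
    have hsize : (Enc.enc (b, c) : Tree α).size =
        (Enc.enc b : Tree α).size + (Enc.enc c : Tree α).size + 1 := rfl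
    simp [Expr.eval, Expr.cost, h, Tree.right, Tree.size, esize]
    omega

theorem comp {f : β → γ} {g : γ → δ} (hg : PolyTime α g) (hf : PolyTime α f) :
    PolyTime α fun b => g (f b) := by
  obtain ⟨c, p, hc⟩ := hf
  obtain ⟨d, q, hd⟩ := hg
  -- The polynomial `p` bounds the size of the intermediate value, hence `q.comp p` bounds the
  -- second run.
  refine ⟨fun k => .seq (c k) (d k), p + q.comp p + 1, fun k s b hb hs => ?_⟩
  obtain ⟨h1, h2⟩ := hc k s b hb hs
  obtain ⟨h3, h4⟩ := hd k (update s k (Enc.enc (f b))) (f b) (by simp) fun j hj => by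
    simp [hj.ne', hs j hj]
  have h5 := polynomial_eval_mono q h2
  rw [update_idem] at h3
  refine ⟨(h1.seq h3).mono ?_, ?_⟩ <;> simp [Polynomial.eval_comp] <;> omega

theorem pair {f : β → γ} {g : β → δ} (hf : PolyTime α f) (hg : PolyTime α g) :
    PolyTime α fun b => (f b, g b) := by
  obtain ⟨c, p, hc⟩ := hf
  obtain ⟨d, q, hd⟩ := hg
  -- Each component is computed on its own copy of the input. The second copy lies beyond the first
  -- result, so that all variables after it are still `nil`; both are reset at the end.
  refine ⟨fun k => .seq (.assign (k + 1) (.var k)) (.seq (c (k + 1))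
    (.seq (.assign (k + 2) (.var k)) (.seq (d (k + 2))
    (.seq (.assign k (.cons (.var (k + 1)) (.var (k + 2))))
    (.seq (.assign (k + 1) (.const .nil)) (.assign (k + 2) (.const .nil))))))),
    2 * .X + 3 * p + 3 * q + 20, fun k s b hb hs => ?_⟩
  have r1 := Runs.assign s (k + 1) (.var k)
  obtain ⟨r2, z2⟩ := hc (k + 1) (update s (k + 1) (s k)) b (by simp [hb]) fun j hj => by
    rw [update_of_ne (by omega), hs j (by omega)]
  rw [update_idem] at r2
  set s2 := update s (k + 1) (Enc.enc (f b)) with hs2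
  have r3 := Runs.assign s2 (k + 2) (.var k)
  have e2 : s2 k = Enc.enc b := by rw [hs2, update_of_ne (by omega), hb]
  obtain ⟨r4, z4⟩ := hd (k + 2) (update s2 (k + 2) (s2 k)) b (by simp [e2]) fun j hj => by
    rw [update_of_ne (by omega), hs2, update_of_ne (by omega), hs j (by omega)]
  rw [update_idem] at r4
  set s4 := update s2 (k + 2) (Enc.enc (g b)) with hs4
  have r5 := Runs.assign s4 k (.cons (.var (k + 1)) (.var (k + 2)))
  have e41 : s4 (k + 1) = Enc.enc (f b) := by
    rw [hs4, update_of_ne (by omega), hs2, update_self]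
  have e42 : s4 (k + 2) = Enc.enc (g b) := by rw [hs4, update_self]
  set s5 := update s4 k ((Expr.cons (.var (k + 1)) (.var (k + 2))).eval s4) with hs5
  have r6 := Runs.assign s5 (k + 1) (.const .nil)
  have r7 := Runs.assign (update s5 (k + 1) .nil) (k + 2) (.const .nil)
  have hfin : update (update s5 (k + 1) .nil) (k + 2) .nil = update s k (Enc.enc (f b, g b)) := by
    funext j
    by_cases h2 : j = k + 2
    · subst h2; simp [hs]
    by_cases h1 : j = k + 1
    · subst h1; simp [hs]
    by_cases h0 : j = k
    · subst h0
      simp [hs5, Expr.eval, e41, e42, Enc.enc]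
    · simp [h0, h1, h2, hs5, hs4, hs2]
  have hr := r1.seq (r2.seq (r3.seq (r4.seq (r5.seq (r6.seq r7)))))
  refine ⟨?_, by simp; omega⟩
  rw [← hfin]
  refine hr.mono ?_
  simp only [Expr.cost, Expr.eval, Tree.size, e2, hb, e41, e42]
  simp only [Polynomial.eval_add, Polynomial.eval_mul, Polynomial.eval_X, Polynomial.eval_ofNat]
  simp only [esize] at *
  omega

theorem ite {f g : β → γ} {t : β → Bool} (ht : PolyTime α t) (hf : PolyTime α f)
    (hg : PolyTime α g) : PolyTime α fun b => if t b then f b else g b := by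
  obtain ⟨c, p, hc⟩ := ht
  obtain ⟨d, q, hd⟩ := hf
  obtain ⟨d', q', hd'⟩ := hg
  refine ⟨fun k => .seq (.assign (k + 1) (.var k)) (.seq (c (k + 1))
    (.cond (.var (k + 1)) (.seq (.assign (k + 1) (.const .nil)) (d k))
      (.seq (.assign (k + 1) (.const .nil)) (d' k)))),
    .X + p + p + q + q' + 20, fun k s b hb hs => ?_⟩
  have r1 := Runs.assign s (k + 1) (.var k)
  obtain ⟨r2, z2⟩ := hc (k + 1) (update s (k + 1) (s k)) b (by simp [hb]) fun j hj => by
    rw [update_of_ne (by omega), hs j (by omega)]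
  rw [update_idem] at r2
  set s2 := update s (k + 1) (Enc.enc (t b)) with hs2
  have r3 := Runs.assign s2 (k + 1) (.const .nil)
  -- The result of the test is cleared before a branch starts, so the branch finds the original
  -- store.
  have e3 : update s2 (k + 1) ((Expr.const .nil).eval s2) = s := by
    rw [hs2, update_idem]
    exact update_eq_self_iff.2 (by simp [Expr.eval, hs])
  rw [e3] at r3
  have e2 : s2 (k + 1) = Enc.enc (t b) := by rw [hs2, update_self]
  obtain ⟨r4, z4⟩ := hd k s b hb hs
  obtain ⟨r5, z5⟩ := hd' k s b hb hs
  have hev : (Expr.eval s2 (.var (k + 1))) = Enc.enc (t b) := e2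
  have hco : (Expr.cost s2 (.var (k + 1))) = esize α (t b) := by simp [Expr.cost, e2, esize]
  have h1 : (Expr.cost s (.var k)) = esize α b := by simp [Expr.cost, hb, esize]
  cases htb : t b with
  | true =>
    have := Runs.condTrue (d := .seq (.assign (k + 1) (.const .nil)) (d' k))
      (by rw [hev, htb]; simp [Enc.enc]) (r3.seq r4)
    simp only [htb, if_true]
    refine ⟨(r1.seq (r2.seq this)).mono ?_, ?_⟩
    · rw [hco, h1]
      simp [Expr.cost, Tree.size]
      omega
    · simp; omega
  | false =>
    have := Runs.condFalse (c := .seq (.assign (k + 1) (.const .nil)) (d k))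
      (by rw [hev, htb]; simp [Enc.enc]) (r3.seq r5)
    simp only [htb, Bool.false_eq_true, if_false]
    refine ⟨(r1.seq (r2.seq this)).mono ?_, ?_⟩
    · rw [hco, h1]
      simp [Expr.cost, Tree.size]
      omega
    · simp; omega

/-- The machine compares encodings, which is the same as comparing values when the encoding is
injective. -/
theorem eqTest [DecidableEq γ] (hinj : Injective (Enc.enc : γ → Tree α)) :
    PolyTime α fun p : γ × γ => decide (p.1 = p.2) :=
  of_expr (fun k => .eq (.hd (.var k)) (.tl (.var k))) (6 * .X + 10) fun k s b h => by
    obtain ⟨b, c⟩ := b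
    have hsize : (Enc.enc (b, c) : Tree α).size =
        (Enc.enc b : Tree α).size + (Enc.enc c : Tree α).size + 1 := rfl
    have h : s k = .node (Enc.enc b) (Enc.enc c) := h
    have h1 := esize_bool_le (α := α) (decide (b = c))
    have h2 : (if (Enc.enc b : Tree α) = Enc.enc c then .node .nil .nil else .nil : Tree α) =
        Enc.enc (decide (b = c)) := by
      by_cases hbc : b = c
      · simp [hbc, Enc.enc]
      · simp [hbc, hinj.ne hbc, Enc.enc]
    simp only [Expr.eval, Expr.cost, h, Tree.left, Tree.right, h2, Tree.size]
    simp [esize] at *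
    omega

theorem eq [DecidableEq γ] (hinj : Injective (Enc.enc : γ → Tree α)) {f g : β → γ}
    (hf : PolyTime α f) (hg : PolyTime α g) : PolyTime α fun b => decide (f b = g b) :=
  (eqTest hinj).comp (hf.pair hg)

theorem and {f g : β → Bool} (hf : PolyTime α f) (hg : PolyTime α g) :
    PolyTime α fun b => f b && g b :=
  (ite hf hg (const false)).of_enc_eq fun b => by cases f b <;> simp

theorem not {f : β → Bool} (hf : PolyTime α f) : PolyTime α fun b => !f b :=
  (ite hf (const false) (const true)).of_enc_eq fun b => by cases f b <;> simp

/-- One round of the loop that folds `step` over a list: the accumulator is in variable `k + 1` and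
the rest of the list in variable `k + 2`. -/
def foldBody (c : ℕ → Cmd α) (k : ℕ) : Cmd α :=
  .seq (.assign (k + 3) (.cons (.cons (.var k) (.var (k + 1))) (.hd (.var (k + 2)))))
    (.seq (c (k + 3)) (.seq (.assign (k + 1) (.var (k + 3)))
      (.seq (.assign (k + 3) (.const .nil)) (.assign (k + 2) (.tl (.var (k + 2)))))))

/-- The bound `B` on all intermediate accumulators must be supplied: iterating a polynomial-time
step could otherwise produce values of exponential size. It bounds the three components of the
step's argument, which therefore has size at most `3 * B + 2`. -/
theorem runs_foldLoop {step : β → γ → δ → γ} {c : ℕ → Cmd α} {p : Polynomial ℕ}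
    (hc : ∀ (k : ℕ) (s : Store α) (b : (β × γ) × δ), s k = Enc.enc b → (∀ j > k, s j = .nil) →
      Runs (c k) s (update s k (Enc.enc (step b.1.1 b.1.2 b.2))) (p.eval (esize α b)))
    (b : β) (B : ℕ) (hb : esize α b ≤ B) (k : ℕ) (s : Store α) (hsk : s k = Enc.enc b)
    (hs : ∀ j > k, s j = .nil) (l : List δ) : ∀ x : γ, esize α l ≤ B →
      (∀ l', l' <+: l → esize α (l'.foldl (step b) x) ≤ B) →
      Runs (.loop (.var (k + 2)) (foldBody c k))
        (update (update s (k + 1) (Enc.enc x)) (k + 2) (Enc.enc l))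
        (update s (k + 1) (Enc.enc (l.foldl (step b) x)))
        (l.length * (p.eval (3 * B + 2) + 20 * B + 20) + 2) := by
  induction l with
  | nil =>
    intro x _ _
    have h : update (update s (k + 1) (Enc.enc x)) (k + 2) (Enc.enc ([] : List δ)) =
        update s (k + 1) (Enc.enc x) := by
      refine update_eq_self_iff.2 ?_
      rw [update_of_ne (by omega), hs _ (by omega)]
      rfl
    rw [h]
    have hev : Expr.eval (update s (k + 1) (Enc.enc x)) (.var (k + 2)) = .nil := by
      simp only [Expr.eval]
      rw [update_of_ne (by omega), hs _ (by omega)]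
    refine (Runs.loopFalse hev).mono ?_
    have : Expr.cost (update s (k + 1) (Enc.enc x)) (.var (k + 2)) = 1 := by
      simp only [Expr.eval] at hev
      simp only [Expr.cost, hev, Tree.size]
    simp [this]
  | cons d l ih =>
    intro x hl hpre
    have hx : esize α x ≤ B := hpre [] List.nil_prefix
    have hx' : esize α (step b x d) ≤ B := hpre [d] (by simp)
    have hl' : esize α (d :: l) = esize α d + esize α l + 1 := rfl
    have ih := ih (step b x d) (by omega) fun l' h =>
      hpre (d :: l') (by simpa using h)
    set s0 := update (update s (k + 1) (Enc.enc x)) (k + 2) (Enc.enc (d :: l)) with hs0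
    have e0 : s0 k = Enc.enc b := by
      rw [hs0, update_of_ne (by omega), update_of_ne (by omega), hsk]
    have e1 : s0 (k + 1) = Enc.enc x := by rw [hs0, update_of_ne (by omega), update_self]
    have e2 : s0 (k + 2) = .node (Enc.enc d) (Enc.enc l) := by rw [hs0, update_self]; rfl
    have e3 : ∀ j > k + 2, s0 j = .nil := fun j hj => by
      rw [hs0, update_of_ne (by omega), update_of_ne (by omega), hs j (by omega)]
    have r1 := Runs.assign s0 (k + 3) (.cons (.cons (.var k) (.var (k + 1))) (.hd (.var (k + 2))))
    have v1 : Expr.eval s0 (.cons (.cons (.var k) (.var (k + 1))) (.hd (.var (k + 2)))) =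
        Enc.enc ((b, x), d) := by
      simp only [Expr.eval, e0, e1, e2, Tree.left]
      rfl
    have c1 : Expr.cost s0 (.cons (.cons (.var k) (.var (k + 1))) (.hd (.var (k + 2)))) =
        3 * esize α b + 3 * esize α x + 3 * esize α d + esize α l + 4 := by
      simp only [Expr.cost, Expr.eval, e0, e1, e2, Tree.left, Tree.size, esize]
      omega
    rw [v1, c1] at r1
    set s1 := update s0 (k + 3) (Enc.enc ((b, x), d)) with hs1
    have r2 := hc (k + 3) s1 ((b, x), d) (by simp [hs1]) fun j hj => by
      rw [hs1, update_of_ne (by omega), e3 j (by omega)]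
    rw [hs1, update_idem] at r2
    set s2 := update s0 (k + 3) (Enc.enc (step b x d)) with hs2
    have r3 := Runs.assign s2 (k + 1) (.var (k + 3))
    have v3 : Expr.eval s2 (.var (k + 3)) = Enc.enc (step b x d) := by
      simp [Expr.eval, hs2]
    have c3 : Expr.cost s2 (.var (k + 3)) = esize α (step b x d) := by
      simp [Expr.cost, hs2, esize]
    rw [v3, c3] at r3
    set s3 := update s2 (k + 1) (Enc.enc (step b x d)) with hs3
    have r4 := Runs.assign s3 (k + 3) (.const .nil)
    set s4 := update s3 (k + 3) (Expr.eval s3 (.const .nil)) with hs4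
    have r5 := Runs.assign s4 (k + 2) (.tl (.var (k + 2)))
    have e4 : s4 (k + 2) = .node (Enc.enc d) (Enc.enc l) := by
      rw [hs4, update_of_ne (by omega), hs3, update_of_ne (by omega), hs2, update_of_ne (by omega),
        e2]
    have v5 : Expr.eval s4 (.tl (.var (k + 2))) = Enc.enc l := by
      simp only [Expr.eval, e4, Tree.right]
    have c5 : Expr.cost s4 (.tl (.var (k + 2))) = esize α d + 2 * esize α l + 1 := by
      simp only [Expr.cost, Expr.eval, e4, Tree.right, Tree.size, esize]
      omega
    rw [v5, c5] at r5
    have hfin : update s4 (k + 2) (Enc.enc l) =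
        update (update s (k + 1) (Enc.enc (step b x d))) (k + 2) (Enc.enc l) := by
      funext j
      by_cases h2 : j = k + 2
      · subst h2; simp
      by_cases h3 : j = k + 3
      · subst h3; simp [hs4, hs, Expr.eval]
      by_cases h1 : j = k + 1
      · subst h1; simp [hs4, hs3]
      · simp [h1, h2, h3, hs4, hs3, hs2, hs0]
    rw [hfin] at r5
    have hbody : Runs (foldBody c k) s0 _ _ := r1.seq (r2.seq (r3.seq (r4.seq r5)))
    have hc0 : Expr.cost s0 (.var (k + 2)) = esize α (d :: l) := by
      simp only [Expr.cost, e2]; rfl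
    have hne : Expr.eval s0 (.var (k + 2)) ≠ .nil := by
      simp only [Expr.eval, e2]; exact fun h => by cases h
    refine (Runs.loopTrue hne hbody ih).mono ?_
    have hp : p.eval (esize α ((b, x), d)) ≤ p.eval (3 * B + 2) :=
      polynomial_eval_mono p (by simp only [esize_pair]; omega)
    rw [hc0]
    simp only [Expr.cost, Tree.size, List.length_cons, add_mul, one_mul]
    omega

theorem foldl {step : β → γ → δ → γ} {init : β → γ} {l : β → List δ}
    (hstep : PolyTime α fun p : (β × γ) × δ => step p.1.1 p.1.2 p.2) (hinit : PolyTime α init)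
    (hl : PolyTime α l) (q : Polynomial ℕ)
    (hq : ∀ b l', l' <+: l b → esize α (l'.foldl (step b) (init b)) ≤ q.eval (esize α b)) :
    PolyTime α fun b => (l b).foldl (step b) (init b) := by
  obtain ⟨c, p, hc⟩ := hstep
  obtain ⟨c₁, p₁, h₁⟩ := hinit
  obtain ⟨c₂, p₂, h₂⟩ := hl
  refine ⟨fun k => .seq (.assign (k + 1) (.var k)) (.seq (c₁ (k + 1))
    (.seq (.assign (k + 2) (.var k)) (.seq (c₂ (k + 2))
    (.seq (.loop (.var (k + 2)) (foldBody c k))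
    (.seq (.assign k (.var (k + 1))) (.assign (k + 1) (.const .nil))))))),
    -- The sum `X + p₂ + q` bounds the input, the list and every accumulator at once; the factor
    -- `p₂` bounds the number of rounds.
    2 * .X + p₁ + p₂ + 2 * q +
      p₂ * (p.comp (3 * (.X + p₂ + q) + 2) + 20 * (.X + p₂ + q) + 20) + 20,
    fun k s b hb hs => ?_⟩
  have r1 := Runs.assign s (k + 1) (.var k)
  obtain ⟨r2, z2⟩ := h₁ (k + 1) (update s (k + 1) (s k)) b (by simp [hb]) fun j hj => by
    rw [update_of_ne (by omega), hs j (by omega)]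
  rw [update_idem] at r2
  set s2 := update s (k + 1) (Enc.enc (init b)) with hs2
  have r3 := Runs.assign s2 (k + 2) (.var k)
  have e2 : s2 k = Enc.enc b := by rw [hs2, update_of_ne (by omega), hb]
  obtain ⟨r4, z4⟩ := h₂ (k + 2) (update s2 (k + 2) (s2 k)) b (by simp [e2]) fun j hj => by
    rw [update_of_ne (by omega), hs2, update_of_ne (by omega), hs j (by omega)]
  rw [update_idem, hs2] at r4
  have hqb := hq b
  set n := esize α b with hn
  have hq1 := hqb _ List.prefix_rfl
  have r5 := runs_foldLoop (fun k s b h1 h2 => (hc k s b h1 h2).1) b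
    (n + p₂.eval n + q.eval n) (by omega) k s hb hs (l b) (init b) (by omega)
    (fun l' h => (hqb l' h).trans (by omega))
  set y := (l b).foldl (step b) (init b) with hy
  set s5 := update s (k + 1) (Enc.enc y) with hs5
  have r6 := Runs.assign s5 k (.var (k + 1))
  have v6 : s5 (k + 1) = Enc.enc y := by rw [hs5, update_self]
  set s6 := update s5 k (Expr.eval s5 (.var (k + 1))) with hs6
  have r7 := Runs.assign s6 (k + 1) (.const .nil)
  have hfin : update s6 (k + 1) (Expr.eval s6 (.const .nil)) = update s k (Enc.enc y) := by
    funext j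
    by_cases h1 : j = k + 1
    · subst h1; simp [hs, Expr.eval]
    by_cases h0 : j = k
    · subst h0; simp [hs6, Expr.eval, v6]
    · simp [h0, h1, hs6, hs5]
  rw [hfin] at r7
  have hlen := length_lt_esize (α := α) (l b)
  refine ⟨(r1.seq (r2.seq (r3.seq (r4.seq (r5.seq (r6.seq r7)))))).mono ?_, ?_⟩
  · have hc1 : Expr.cost s (.var k) = n := by simp only [Expr.cost, hb]; rfl
    have hc3 : Expr.cost s2 (.var k) = n := by simp only [Expr.cost, e2]; rfl
    have hc6 : Expr.cost s5 (.var (k + 1)) = esize α y := by simp only [Expr.cost, v6]; rfl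
    rw [hc1, hc3, hc6]
    simp only [Expr.cost, Tree.size, Polynomial.eval_add, Polynomial.eval_mul, Polynomial.eval_comp,
      Polynomial.eval_X, Polynomial.eval_ofNat]
    have := Nat.mul_le_mul_right (p.eval (3 * (n + p₂.eval n + q.eval n) + 2) +
      20 * (n + p₂.eval n + q.eval n) + 20) (show (l b).length ≤ p₂.eval n by omega)
    omega
  · simp only [Polynomial.eval_add, Polynomial.eval_mul, Polynomial.eval_comp,
      Polynomial.eval_X, Polynomial.eval_ofNat]
    change esize α y ≤ _
    omega

theorem cons {f : β → γ} {g : β → List γ} (hf : PolyTime α f) (hg : PolyTime α g) :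
    PolyTime α fun b => f b :: g b :=
  (hf.pair hg).of_enc_eq fun _ => rfl

theorem reverse {f : β → List γ} (hf : PolyTime α f) : PolyTime α fun b => (f b).reverse := by
  have key : ∀ l acc : List γ, l.foldl (fun acc x => x :: acc) acc = l.reverse ++ acc := by
    intro l
    induction l with
    | nil => simp
    | cons x l ih => simp [ih]
  have h : PolyTime α fun l : List γ => l.foldl (fun acc x => x :: acc) [] := by
    refine foldl (step := fun _ acc x => x :: acc) (init := fun _ => []) (l := fun l => l)
      (cons snd (snd.comp fst)) (const []) id .X fun l l' h => ?_
    rw [key, List.append_nil, esize_reverse, Polynomial.eval_X]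
    exact esize_le_of_prefix h
  have h' := h.comp hf
  simp only [key, List.append_nil] at h'
  exact h'

theorem foldr {step : β → δ → γ → γ} {init : β → γ} {l : β → List δ}
    (hstep : PolyTime α fun p : (β × γ) × δ => step p.1.1 p.2 p.1.2) (hinit : PolyTime α init)
    (hl : PolyTime α l) (q : Polynomial ℕ)
    (hq : ∀ b l', l' <:+ l b → esize α (l'.foldr (step b) (init b)) ≤ q.eval (esize α b)) :
    PolyTime α fun b => (l b).foldr (step b) (init b) := by
  have := foldl (step := fun b x d => step b d x) hstep hinit hl.reverse q fun b l' h => by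
    rw [← List.reverse_reverse l', List.foldl_reverse]
    exact hq b l'.reverse (by simpa using List.reverse_suffix.2 h)
  simpa only [List.foldl_reverse] using this

theorem append {f g : β → List γ} (hf : PolyTime α f) (hg : PolyTime α g) :
    PolyTime α fun b => f b ++ g b := by
  obtain ⟨p, hp⟩ := hf.esize_le
  obtain ⟨q, hq⟩ := hg.esize_le
  have := foldr (step := fun _ x acc => x :: acc) (cons snd (snd.comp fst)) hg hf (p + q)
    fun b l' h => by
      have h1 := esize_le_of_suffix (α := α) h
      have h2 := esize_append (α := α) l' (g b)
      have := hp b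
      have := hq b
      simp
      omega
  simpa using this

theorem flatMap {f : β → List γ} {g : β → γ → List δ} (hf : PolyTime α f)
    (hg : PolyTime α fun p : β × γ => g p.1 p.2) : PolyTime α fun b => (f b).flatMap (g b) := by
  obtain ⟨p, hp⟩ := hf.esize_le
  obtain ⟨q, hq⟩ := hg.esize_le
  have := foldr (step := fun b x acc => g b x ++ acc) (init := fun _ => ([] : List δ))
    (append (hg.comp ((fst.comp fst).pair snd)) (snd.comp fst)) (const []) hf
    -- There are at most `p` list elements, and each is processed together with `b` as a pair of
    -- size at most `X + p + 1`.
    (p * q.comp (.X + p + 1) + 1) fun b l' h => by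
      have hl : l'.length ≤ p.eval (esize α b) := by
        have := length_lt_esize (α := α) l'
        have := esize_le_of_suffix (α := α) h
        have := hp b
        omega
      have key : esize α (l'.foldr (fun x acc => g b x ++ acc) []) ≤
          l'.length * q.eval (esize α b + p.eval (esize α b) + 1) + 1 := by
        clear hl
        induction l' with
        | nil => simp
        | cons x l' ih =>
          have ih := ih ((List.suffix_cons x l').trans h)
          have h1 := esize_append (α := α) (g b x) (l'.foldr (fun x acc => g b x ++ acc) [])
          have h2 : esize α x ≤ p.eval (esize α b) :=
            (esize_le_of_mem (h.subset (by simp))).trans (hp b)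
          have h3 := (hq (b, x)).trans (polynomial_eval_mono q (n :=
            esize α b + p.eval (esize α b) + 1) (by simp; omega))
          simp only [List.foldr_cons, List.length_cons, add_mul, one_mul]
          simp only at h3
          omega
      refine key.trans ?_
      simp [Polynomial.eval_comp]
      gcongr
  have h : (fun b => (f b).flatMap (g b)) =
      fun b => (f b).foldr (fun x acc => g b x ++ acc) [] := by
    funext b
    induction f b with
    | nil => rfl
    | cons x l ih => simp [ih]
  rwa [h]

theorem map {f : β → List γ} {g : β → γ → δ} (hf : PolyTime α f)
    (hg : PolyTime α fun p : β × γ => g p.1 p.2) : PolyTime α fun b => (f b).map (g b) := by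
  have := flatMap (g := fun b x => [g b x]) hf (cons hg (const []))
  have h : (fun b => (f b).map (g b)) = fun b => (f b).flatMap fun x => [g b x] := by
    funext b
    induction f b with
    | nil => rfl
    | cons x l ih => simp [ih]
  rwa [h]

theorem filter {f : β → List γ} {g : β → γ → Bool} (hf : PolyTime α f)
    (hg : PolyTime α fun p : β × γ => g p.1 p.2) : PolyTime α fun b => (f b).filter (g b) := by
  have := flatMap (g := fun b x => if g b x then [x] else []) hf
    (ite hg (cons snd (const [])) (const []))
  have h : (fun b => (f b).filter (g b)) =
      fun b => (f b).flatMap fun x => if g b x then [x] else [] := by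
    funext b
    induction f b with
    | nil => rfl
    | cons x l ih => by_cases hx : g b x <;> simp [hx, ih]
  rwa [h]

/-- A lookup table: nested equality tests against the finitely many arguments. -/
theorem of_finite [Finite β] (hinj : Injective (Enc.enc : β → Tree α)) (f : β → γ) :
    PolyTime α f := by
  classical
  have := Fintype.ofFinite β
  cases isEmpty_or_nonempty β with
  | inl h => exact ⟨fun _ => .skip, 0, fun _ _ b => h.elim b⟩
  | inr h =>
    have key : ∀ l : List β, ∃ g : β → γ, PolyTime α g ∧ ∀ b ∈ l, g b = f b := by
      intro l
      induction l with
      | nil => exact ⟨_, const (f h.some), by simp⟩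
      | cons x l ih =>
        obtain ⟨g, hg, hgl⟩ := ih
        refine ⟨_, ite (eq hinj id (const x)) (const (f x)) hg, fun b hb => ?_⟩
        by_cases hbx : b = x
        · simp [hbx]
        · simpa [hbx] using hgl b ((List.mem_cons.1 hb).resolve_left hbx)
    obtain ⟨g, hg, h⟩ := key Finset.univ.toList
    have : f = g := funext fun b => (h b (by simp)).symm
    rwa [this]

end PolyTime

/-! ### Deciding the relation -/

section Relocation

variable {α : Type}

/-- The expression with all variables shifted by `k`. -/
def Expr.shift (k : ℕ) : Expr α → Expr α
  | .var i => .var (k + i)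
  | .const t => .const t
  | .cons e f => .cons (e.shift k) (f.shift k)
  | .hd e => .hd (e.shift k)
  | .tl e => .tl (e.shift k)
  | .eq e f => .eq (e.shift k) (f.shift k)

/-- The command with all variables shifted by `k`. -/
def Cmd.shift (k : ℕ) : Cmd α → Cmd α
  | .skip => .skip
  | .assign i e => .assign (k + i) (e.shift k)
  | .seq c d => .seq (c.shift k) (d.shift k)
  | .cond e c d => .cond (e.shift k) (c.shift k) (d.shift k)
  | .loop e c => .loop (e.shift k) (c.shift k)

/-- A bound for the variables that the command assigns to. -/
def Cmd.bound : Cmd α → ℕ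
  | .skip => 0
  | .assign i _ => i + 1
  | .seq c d => max c.bound d.bound
  | .cond _ c d => max c.bound d.bound
  | .loop _ c => c.bound

/-- The store that agrees with `s₀` before `k` and with a shifted copy of `s` from `k` on. -/
def Store.splice (k : ℕ) (s₀ s : Store α) : Store α := fun j => if j < k then s₀ j else s (j - k)

theorem Store.splice_add (k : ℕ) (s₀ s : Store α) (i : ℕ) : Store.splice k s₀ s (k + i) = s i := by
  simp [Store.splice]

variable [DecidableEq α]

theorem Expr.eval_shift (k : ℕ) (s₀ s : Store α) (e : Expr α) :
    (e.shift k).eval (Store.splice k s₀ s) = e.eval s := by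
  induction e <;> simp_all [Expr.shift, Expr.eval, Store.splice_add]

theorem Expr.cost_shift (k : ℕ) (s₀ s : Store α) (e : Expr α) :
    (e.shift k).cost (Store.splice k s₀ s) = e.cost s := by
  induction e with
  | var i => simp [Expr.shift, Expr.cost, Store.splice_add]
  | const t => rfl
  | _ => simp_all [Expr.shift, Expr.cost, Expr.eval, Expr.eval_shift]

/-- Renaming variables changes neither values nor costs. A program written for input in variable `0`
can thus be used as a subroutine at any place of the store. -/
theorem Exec.shift (k : ℕ) (s₀ : Store α) {c : Cmd α} {s s' : Store α} {n : ℕ}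
    (h : Exec c s n s') : Exec (c.shift k) (Store.splice k s₀ s) n (Store.splice k s₀ s') := by
  induction h with
  | skip s => exact .skip _
  | assign s i e =>
    have := Exec.assign (Store.splice k s₀ s) (k + i) (e.shift k)
    rw [Expr.eval_shift, Expr.cost_shift] at this
    change Exec (.assign (k + i) (e.shift k)) _ _ _
    convert this using 1
    funext j
    simp only [Store.splice, update_apply]
    by_cases hj : j < k
    · simp [hj, show j ≠ k + i by omega]
    · simp [hj, show j - k = i ↔ j = k + i by omega]
  | seq _ _ hc hd => exact .seq hc hd
  | @condTrue e c d s s' n he _ hc =>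
    have := Exec.condTrue (d := d.shift k) (by rwa [Expr.eval_shift]) hc
    rw [Expr.cost_shift] at this
    exact this
  | @condFalse e c d s s' n he _ hd =>
    have := Exec.condFalse (c := c.shift k) (by rwa [Expr.eval_shift]) hd
    rw [Expr.cost_shift] at this
    exact this
  | loopTrue he _ _ hc hl =>
    have := Exec.loopTrue (by rwa [Expr.eval_shift]) hc hl
    rw [Expr.cost_shift] at this
    exact this
  | @loopFalse e c s he =>
    have := Exec.loopFalse (c := c.shift k) (e := e.shift k) (s := Store.splice k s₀ s)
      (by rwa [Expr.eval_shift])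
    rw [Expr.cost_shift] at this
    exact this

theorem Exec.eq_of_bound_le {c : Cmd α} {s s' : Store α} {n : ℕ} (h : Exec c s n s') :
    ∀ i, c.bound ≤ i → s' i = s i := by
  induction h with
  | skip s => simp
  | assign s j e =>
    intro i hi
    simp only [Cmd.bound] at hi
    rw [update_of_ne (by omega)]
  | seq _ _ hc hd =>
    intro i hi
    simp only [Cmd.bound, max_le_iff] at hi
    rw [hd i hi.2, hc i hi.1]
  | condTrue _ _ hc =>
    intro i hi
    simp only [Cmd.bound, max_le_iff] at hi
    exact hc i hi.1
  | condFalse _ _ hd =>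
    intro i hi
    simp only [Cmd.bound, max_le_iff] at hi
    exact hd i hi.2
  | loopTrue _ _ _ hc hl => exact fun i hi => (hl i hi).trans (hc i hi)
  | loopFalse _ => simp

theorem Expr.size_eval_le_cost (s : Store α) (e : Expr α) : (e.eval s).size ≤ e.cost s := by
  cases e <;> simp [Expr.eval, Expr.cost]

/-- Building a value costs its size, so time bounds growth. It is needed because the answer of a
decision program may be any tree, and testing it is charged its size. -/
theorem Exec.size_le {c : Cmd α} {s s' : Store α} {n : ℕ} (h : Exec c s n s') :
    ∀ i, (s' i).size ≤ (s i).size + n := by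
  induction h with
  | skip s => simp
  | assign s j e =>
    intro i
    have := e.size_eval_le_cost s
    by_cases hi : i = j
    · subst hi
      rw [update_self]
      omega
    · rw [update_of_ne hi]
      omega
  | seq _ _ hc hd =>
    intro i
    have := hc i
    have := hd i
    omega
  | condTrue _ _ hc =>
    intro i
    have := hc i
    omega
  | condFalse _ _ hd =>
    intro i
    have := hd i
    omega
  | loopTrue _ _ _ hc hl =>
    intro i
    have := hc i
    have := hl i
    omega
  | loopFalse _ => simp

/-- Resets `N` variables from `k` on. -/
def Cmd.clear (k : ℕ) : ℕ → Cmd α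
  | 0 => .skip
  | N + 1 => .seq (.assign (k + N) (.const .nil)) (Cmd.clear k N)

theorem runs_clear (k N : ℕ) : ∀ s : Store α,
    Runs (Cmd.clear k N) s (fun j => if k ≤ j ∧ j < k + N then .nil else s j) (3 * N + 1) := by
  induction N with
  | zero =>
    intro s
    have : (fun j => if k ≤ j ∧ j < k + 0 then .nil else s j) = s := by
      funext j
      rw [if_neg (by omega)]
    rw [this]
    exact ⟨1, by omega, .skip s⟩
  | succ N ih =>
    intro s
    have := (Runs.assign s (k + N) (.const .nil)).seq (ih _)
    change Runs (.seq _ _) _ _ _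
    convert this.mono (N := 3 * (N + 1) + 1) (by simp [Expr.cost, Tree.size]; omega) using 1
    funext j
    by_cases h1 : j = k + N
    · subst h1
      simp [Expr.eval]
    · rw [update_of_ne h1]
      by_cases h2 : k ≤ j ∧ j < k + N
      · rw [if_pos h2, if_pos (by omega)]
      · rw [if_neg h2, if_neg (by omega)]

-- The decision program runs on a copy of the input in the variables after `k`. It may leave garbage
-- there, but only in variables below its syntactic bound, so a fixed number of assignments restores
-- the store.
open Classical in
theorem PolyTimeDecidable.polyTime {r : List α → List α → Prop} (h : PolyTimeDecidable r) :
    PolyTime α fun p : List α × List α => decide (r p.1 p.2) := by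
  obtain ⟨c, p, hc⟩ := h
  refine ⟨fun k => .seq (.assign (k + 1) (.var k)) (.seq (c.shift (k + 1))
    (.cond (.var (k + 1))
      (.seq (Cmd.clear (k + 1) (c.bound + 1)) (.assign k (.const (Enc.enc true))))
      (.seq (Cmd.clear (k + 1) (c.bound + 1)) (.assign k (.const (Enc.enc false)))))),
    -- One `X` pays for the copy and one `p` for the run; the other `X + p` pays for testing an
    -- answer whose size is at most input plus time. The constant covers the clearing.
    2 * .X + 2 * p + .C (3 * c.bound + 20), fun k s b hb hs => ?_⟩
  obtain ⟨x, y⟩ := b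
  obtain ⟨n, s', hexec, hn, hr⟩ := hc x y
  have hn' : n ≤ p.eval (esize α (x, y)) := hn.trans <| polynomial_eval_mono p <| by
    rw [esize_pair, esize_word, esize_word]
    omega
  have r1 := Runs.assign s (k + 1) (.var k)
  have e1 : update s (k + 1) (Expr.eval s (.var k)) =
      Store.splice (k + 1) s (inputStore (Enc.enc (x, y))) := by
    funext j
    by_cases hj : j = k + 1
    · subst hj
      simp [Expr.eval, hb, Store.splice, inputStore]
    · rw [update_of_ne hj]
      by_cases hj' : j < k + 1
      · simp [Store.splice, hj']
      · simp [Store.splice, hj', inputStore, hs j (by omega), show j - (k + 1) ≠ 0 by omega]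
  rw [e1] at r1
  have r2 : Runs _ _ _ n := ⟨n, le_rfl, hexec.shift (k + 1) s⟩
  set s2 := Store.splice (k + 1) s s' with hs2
  have r3 := runs_clear (k + 1) (c.bound + 1) s2
  have e3 : (fun j => if k + 1 ≤ j ∧ j < k + 1 + (c.bound + 1) then .nil else s2 j) = s := by
    funext j
    by_cases hj : k + 1 ≤ j ∧ j < k + 1 + (c.bound + 1)
    · rw [if_pos hj, hs j (by omega)]
    · rw [if_neg hj]
      by_cases hj' : j < k + 1
      · simp [hs2, Store.splice, hj']
      · simp only [hs2, Store.splice, if_neg hj']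
        rw [hexec.eq_of_bound_le _ (by omega), hs j (by omega), inputStore, if_neg (by omega)]
  rw [e3] at r3
  have e2 : s2 (k + 1) = s' 0 := by simp [hs2, Store.splice]
  have hsize : (s2 (k + 1)).size ≤ esize α (x, y) + n := by
    rw [e2]
    exact hexec.size_le 0
  have hc1 : Expr.cost s (.var k) = esize α (x, y) := by simp [Expr.cost, hb, esize]
  have hbool := esize_bool_le (α := α) (decide (r x y))
  refine ⟨?_, ?_⟩
  · by_cases hxy : r x y
    · have r4 := Runs.assign s k (.const (Enc.enc true))
      have r5 := Runs.condTrue (e := .var (k + 1))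
        (d := .seq (Cmd.clear (k + 1) (c.bound + 1)) (.assign k (.const (Enc.enc false))))
        (by simp only [Expr.eval, e2]; exact hr.2 hxy) (r3.seq r4)
      simp only [hxy, decide_true]
      refine (r1.seq (r2.seq r5)).mono ?_
      rw [hc1]
      simp [Expr.cost, Enc.enc, Tree.size, -esize_pair]
      omega
    · have r4 := Runs.assign s k (.const (Enc.enc false))
      have r5 := Runs.condFalse (e := .var (k + 1))
        (c := .seq (Cmd.clear (k + 1) (c.bound + 1)) (.assign k (.const (Enc.enc true))))
        (by simp only [Expr.eval, e2]; exact not_not.1 (mt hr.1 hxy)) (r3.seq r4)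
      simp only [hxy, decide_false]
      refine (r1.seq (r2.seq r5)).mono ?_
      rw [hc1]
      simp [Expr.cost, Enc.enc, Tree.size, -esize_pair]
      omega
  · simp
    omega

end Relocation

/-- A natural number as a tree. -/
def natTree {α : Type} : ℕ → Tree α
  | 0 => .nil
  | n + 1 => .node .nil (natTree n)

theorem natTree_injective {α : Type} : Injective (natTree : ℕ → Tree α) := by
  intro m
  induction m with
  | zero => intro n h; cases n with
    | zero => rfl
    | succ n => cases h
  | succ m ih => intro n h; cases n with
    | zero => cases h
    | succ n => injection h with _ h; rw [ih h]

theorem size_natTree {α : Type} (n : ℕ) : (natTree n : Tree α).size = 2 * n + 1 := by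
  induction n with
  | zero => rfl
  | succ n ih => simp [natTree, Tree.size, ih]; omega

theorem encList_injective {α β : Type} {enc : β → Tree α} (h : Injective enc) :
    Injective (encList enc) := by
  intro l
  induction l with
  | nil => intro l' h'; cases l' with
    | nil => rfl
    | cons b l' => cases h'
  | cons b l ih => intro l' h'; cases l' with
    | nil => cases h'
    | cons b' l' =>
      injection h' with h1 h2
      rw [h h1, ih h2]

theorem enc_letter_injective {α : Type} : Injective (Enc.enc : α → Tree α) :=
  fun _ _ h => by injection h

theorem enc_word_injective {α : Type} : Injective (Enc.enc : List α → Tree α) :=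
  encList_injective enc_letter_injective

theorem enc_prod_injective {α β γ : Type} [Enc α β] [Enc α γ]
    (hβ : Injective (Enc.enc : β → Tree α)) (hγ : Injective (Enc.enc : γ → Tree α)) :
    Injective (Enc.enc : β × γ → Tree α) := fun p q h => by
  injection h with h1 h2
  exact Prod.ext (hβ h1) (hγ h2)

-- The homomorphism is evaluated by a fold over the word whose accumulator lies in the finite
-- monoid. Multiplication by the value of a letter and membership in `F` are lookup tables.
open Classical in
theorem Recognizable.polyTime {α : Type} [DecidableEq α] [Finite α] {r : List α → List α → Prop}
    (h : Recognizable r) : PolyTime α fun p : List α × List α => decide (r p.1 p.2) := by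
  obtain ⟨M, _, _, h, F, hF⟩ := h
  obtain ⟨n, ⟨e⟩⟩ := Finite.exists_equiv_fin M
  -- Any injective encoding would do; this one bounds every accumulator by the constant `2 * n + 1`.
  let _ : Enc α M := ⟨fun m => natTree (e m)⟩
  have hinj : Injective (Enc.enc : M → Tree α) := fun a b hab =>
    e.injective (Fin.ext (natTree_injective hab))
  have hsize : ∀ m : M, esize α m ≤ 2 * n + 1 := fun m => by
    have : esize α m = 2 * (e m : ℕ) + 1 := size_natTree _
    have := (e m).isLt
    omega
  have hw : PolyTime α fun w : List α => h (FreeMonoid.ofList w) := by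
    have := PolyTime.foldl (α := α) (step := fun (_ : List α) (m : M) a => m * h (FreeMonoid.of a))
      (init := fun _ => 1) (l := fun w => w)
      ((PolyTime.of_finite (enc_prod_injective hinj enc_letter_injective)
        fun q : M × α => q.1 * h (FreeMonoid.of q.2)).comp
        ((PolyTime.snd.comp PolyTime.fst).pair PolyTime.snd))
      (PolyTime.const 1) PolyTime.id (.C (2 * n + 1)) fun _ _ _ => by
        rw [Polynomial.eval_C]
        exact hsize _
    have key : ∀ (w : List α) (m : M), w.foldl (fun m a => m * h (FreeMonoid.of a)) m =
        m * h (FreeMonoid.ofList w) := by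
      intro w
      induction w with
      | nil => intro m; simp
      | cons a w ih => intro m; simp [ih, FreeMonoid.ofList_cons, mul_assoc]
    simpa only [key, one_mul] using this
  have := (PolyTime.of_finite (enc_prod_injective hinj hinj) fun q : M × M => decide (q ∈ F)).comp
    ((hw.comp PolyTime.fst).pair (hw.comp PolyTime.snd))
  simpa only [hF] using this

/-! ### Computing the hypothesis grammar -/

/-- All factorizations of a word into two words. -/
def splits {α : Type} : List α → List (List α × List α)
  | [] => [([], [])]
  | a :: w => ([], a :: w) :: (splits w).map fun p => (a :: p.1, p.2)

/-- Rules of the hypothesis grammars. -/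
abbrev HatRule (α : Type) : Type := ContextFreeRule α (Option (List α))

/-- A word `x` with a context `(u, v)`, as `(u, x, v)`. -/
abbrev Occurrence (α : Type) : Type := List α × (List α × List α)

/-- All factorizations `(u, x, v)` of the given words with `x ≠ λ`. -/
def occurrences {α : Type} [DecidableEq α] (l : List (List α)) :
    List (Occurrence α) :=
  l.flatMap fun w => (splits w).flatMap fun p =>
    ((splits p.2).filter fun q => !decide (q.1 = [])).map fun q => (p.1, q)

section Splits

variable {α : Type}

theorem mem_splits (w : List α) (p : List α × List α) : p ∈ splits w ↔ p.1 ++ p.2 = w := by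
  obtain ⟨u, v⟩ := p
  induction w generalizing u with
  | nil => simp [splits]
  | cons a w ih =>
    simp only [splits, List.mem_cons, List.mem_map, Prod.mk.injEq, Prod.exists]
    constructor
    · rintro (⟨rfl, rfl⟩ | ⟨u', v', h, rfl, rfl⟩)
      · rfl
      · simpa using (ih u').1 h
    · intro h
      cases u with
      | nil => exact .inl ⟨rfl, h⟩
      | cons b u =>
        obtain ⟨hb, h⟩ : b = a ∧ u ++ v = w := by simpa using h
        exact .inr ⟨u, v, (ih u).2 h, by rw [hb], rfl⟩

theorem length_splits (w : List α) : (splits w).length = w.length + 1 := by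
  induction w with
  | nil => rfl
  | cons a w ih => simp [splits, ih]

theorem esize_splits_le (w : List α) :
    esize α (splits w) ≤ (w.length + 1) * (2 * w.length + 4) + 1 := by
  rw [← length_splits w]
  refine esize_le_length_mul fun p hp => ?_
  have := congrArg List.length ((mem_splits w p).1 hp)
  have h : esize α p = esize α p.1 + esize α p.2 + 1 := rfl
  rw [h, esize_word, esize_word]
  simp at this
  omega

variable [DecidableEq α]

theorem mem_occurrences (l : List (List α)) (t : Occurrence α) :
    t ∈ occurrences l ↔ t.2.1 ≠ [] ∧ t.1 ++ t.2.1 ++ t.2.2 ∈ l := by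
  obtain ⟨u, x, v⟩ := t
  simp only [occurrences, List.mem_flatMap, List.mem_map, List.mem_filter, mem_splits,
    Prod.exists, Prod.mk.injEq]
  constructor
  · rintro ⟨w, hw, u, z, rfl, x, v, ⟨rfl, hx⟩, rfl, rfl, rfl⟩
    exact ⟨by simpa using hx, by simpa using hw⟩
  · rintro ⟨hx, hw⟩
    exact ⟨_, hw, u, x ++ v, by simp, x, v, ⟨rfl, by simpa using hx⟩, rfl, rfl, rfl⟩

theorem polyTime_splits : PolyTime α (splits : List α → List (List α × List α)) := by
  -- The fold carries the suffix read so far along with its splits, since the new split with empty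
  -- left part needs the whole suffix.
  have key : ∀ w : List α, w.foldr (fun a s => (a :: s.1, ([], a :: s.1) ::
      s.2.map fun p => (a :: p.1, p.2))) (([] : List α), [(([] : List α), ([] : List α))]) =
      (w, splits w) := by
    intro w
    induction w with
    | nil => rfl
    | cons a w ih => rw [List.foldr_cons, ih]; rfl
  have hcons : PolyTime α fun p : (List α × (List α × List (List α × List α))) × α =>
      p.2 :: p.1.2.1 :=
    PolyTime.cons PolyTime.snd (PolyTime.fst.comp (PolyTime.snd.comp PolyTime.fst))
  have := PolyTime.foldr (α := α)
    (step := fun (_ : List α) a (s : List α × List (List α × List α)) =>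
      (a :: s.1, ([], a :: s.1) :: s.2.map fun p => (a :: p.1, p.2)))
    (init := fun _ => ([], [([], [])])) (l := fun w => w)
    (hcons.pair (PolyTime.cons ((PolyTime.const []).pair hcons)
      (PolyTime.map (g := fun (p : (List α × (List α × List (List α × List α))) × α)
          (q : List α × List α) => (p.2 :: q.1, q.2))
        (PolyTime.snd.comp (PolyTime.snd.comp PolyTime.fst))
        ((PolyTime.cons (PolyTime.snd.comp PolyTime.fst) (PolyTime.fst.comp PolyTime.snd)).pair
          (PolyTime.snd.comp PolyTime.snd)))))
    (PolyTime.const _) PolyTime.id ((.X + 1) * (2 * .X + 4) + .X + 2) fun w w' h => by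
      rw [key, esize_pair]
      have h1 := esize_splits_le w'
      have h2 := h.length_le
      have h3 := length_lt_esize (α := α) w
      have h4 := esize_le_of_suffix (α := α) h
      have h5 : (w'.length + 1) * (2 * w'.length + 4) ≤
          (esize α w + 1) * (2 * esize α w + 4) := by gcongr <;> omega
      simp only [Polynomial.eval_add, Polynomial.eval_mul, Polynomial.eval_X, Polynomial.eval_ofNat,
        Polynomial.eval_one]
      omega
  simp only [key] at this
  exact PolyTime.snd.comp this

theorem PolyTime.wordEq {β : Type} [Enc α β] {f g : β → List α} (hf : PolyTime α f)
    (hg : PolyTime α g) : PolyTime α fun b => decide (f b = g b) :=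
  PolyTime.eq enc_word_injective hf hg

theorem polyTime_occurrences :
    PolyTime α (occurrences : List (List α) → List (Occurrence α)) :=
  PolyTime.flatMap (g := fun _ w => (splits w).flatMap fun p =>
    ((splits p.2).filter fun q => !decide (q.1 = [])).map fun q => (p.1, q)) PolyTime.id <|
  PolyTime.flatMap (g := fun _ p =>
    ((splits p.2).filter fun q => !decide (q.1 = [])).map fun q => (p.1, q))
    (polyTime_splits.comp PolyTime.snd) <|
  PolyTime.map (g := fun b q => (b.2.1, q))
    (PolyTime.filter (g := fun _ q => !decide (q.1 = []))
      (polyTime_splits.comp (PolyTime.snd.comp PolyTime.snd))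
      (PolyTime.not ((PolyTime.fst.comp PolyTime.snd).wordEq (PolyTime.const []))))
    ((PolyTime.fst.comp (PolyTime.snd.comp PolyTime.fst)).pair PolyTime.snd)

end Splits

/-! ### The rules of the hypothesis grammar as computable lists. -/

section Learner

variable {α : Type} [DecidableEq α] {β : Type} [Enc α β]

theorem PolyTime.some {f : β → List α} (hf : PolyTime α f) : PolyTime α fun b => some (f b) :=
  ((PolyTime.const ([] : List α)).pair hf).of_enc_eq fun _ => rfl

theorem PolyTime.nonterminal {f : β → List α} (hf : PolyTime α f) :
    PolyTime α fun b => (Symbol.nonterminal (.some (f b)) : Symbol α (Option (List α))) :=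
  hf.some.of_enc_eq fun _ => rfl

theorem PolyTime.rule {f : β → Option (List α)} {g : β → List (Symbol α (Option (List α)))}
    (hf : PolyTime α f) (hg : PolyTime α g) :
    PolyTime α fun b => (⟨f b, g b⟩ : HatRule α) :=
  (hf.pair hg).of_enc_eq fun _ => rfl

theorem PolyTime.terminals {f : β → List α} (hf : PolyTime α f) :
    PolyTime α fun b => (f b).map (Symbol.terminal : α → Symbol α (Option (List α))) :=
  hf.of_enc_eq fun b => by
    induction f b with
    | nil => rfl
    | cons a w ih =>
      change Tree.node _ _ = Tree.node _ _
      congr 1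

/-- The rules `[xy] → [x][y]`. -/
def branchRules (l : List (List α)) : List (HatRule α) :=
  (occurrences l).flatMap fun t =>
    ((splits t.2.1).filter fun p => !decide (p.1 = []) && !decide (p.2 = [])).map fun p =>
      ⟨.some t.2.1, [.nonterminal (.some p.1), .nonterminal (.some p.2)]⟩

/-- The rules `[x] → [y]`, where `R` decides the relation. -/
def unitRules (R : List α × List α → Bool) (l : List (List α)) :
    List (HatRule α) :=
  (occurrences l).flatMap fun t =>
    ((occurrences l).filter fun t' =>
      decide (t.1 = t'.1) && (decide (t.2.2 = t'.2.2) && R (t.2.1, t'.2.1))).map fun t' =>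
        ⟨.some t.2.1, [.nonterminal (.some t'.2.1)]⟩

/-- The rules `[a] → a`. -/
def letterRules (l : List (List α)) : List (HatRule α) :=
  ((occurrences l).filter fun t => decide (t.2.1.tail = [])).map fun t =>
    ⟨.some t.2.1, t.2.1.map .terminal⟩

/-- The rules for the start symbol. -/
def startRules (l : List (List α)) : List (HatRule α) :=
  l.map fun w => ⟨none, if decide (w = []) then [] else [.nonterminal (.some w)]⟩

theorem polyTime_branchRules : PolyTime α (branchRules (α := α)) :=
  PolyTime.flatMap (g := fun (_ : List (List α)) (t : Occurrence α) =>
    ((splits t.2.1).filter fun p : List α × List α => !decide (p.1 = []) && !decide (p.2 = [])).map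
      fun p : List α × List α =>
        (⟨.some t.2.1, [.nonterminal (.some p.1), .nonterminal (.some p.2)]⟩ : HatRule α))
    polyTime_occurrences <|
  PolyTime.map (g := fun (b : List (List α) × Occurrence α) (p : List α × List α) =>
    (⟨.some b.2.2.1, [.nonterminal (.some p.1), .nonterminal (.some p.2)]⟩ : HatRule α))
    (PolyTime.filter (g := fun _ p => !decide (p.1 = []) && !decide (p.2 = []))
      (polyTime_splits.comp (PolyTime.fst.comp (PolyTime.snd.comp PolyTime.snd)))
      (PolyTime.and
        (PolyTime.not ((PolyTime.fst.comp PolyTime.snd).wordEq (PolyTime.const [])))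
        (PolyTime.not ((PolyTime.snd.comp PolyTime.snd).wordEq (PolyTime.const [])))))
    (PolyTime.rule
      (PolyTime.some (PolyTime.fst.comp (PolyTime.snd.comp (PolyTime.snd.comp PolyTime.fst))))
      (PolyTime.cons (PolyTime.nonterminal (PolyTime.fst.comp PolyTime.snd))
        (PolyTime.cons (PolyTime.nonterminal (PolyTime.snd.comp PolyTime.snd))
          (PolyTime.const []))))

theorem polyTime_unitRules {R : List α × List α → Bool} (hR : PolyTime α R) :
    PolyTime α (unitRules R) :=
  PolyTime.flatMap (g := fun (l : List (List α)) (t : Occurrence α) =>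
    ((occurrences l).filter fun t' : Occurrence α =>
      decide (t.1 = t'.1) && (decide (t.2.2 = t'.2.2) && R (t.2.1, t'.2.1))).map
        fun t' : Occurrence α =>
        (⟨.some t.2.1, [.nonterminal (.some t'.2.1)]⟩ : HatRule α))
    polyTime_occurrences <|
  PolyTime.map (g := fun (b : List (List α) × Occurrence α) (t' : Occurrence α) =>
    (⟨.some b.2.2.1, [.nonterminal (.some t'.2.1)]⟩ : HatRule α))
    (PolyTime.filter (g := fun (b : List (List α) × Occurrence α) (t' : Occurrence α) =>
        decide (b.2.1 = t'.1) && (decide (b.2.2.2 = t'.2.2) && R (b.2.2.1, t'.2.1)))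
      (polyTime_occurrences.comp PolyTime.fst)
      (PolyTime.and
        ((PolyTime.fst.comp (PolyTime.snd.comp PolyTime.fst)).wordEq
          (PolyTime.fst.comp PolyTime.snd))
        (PolyTime.and
          ((PolyTime.snd.comp (PolyTime.snd.comp (PolyTime.snd.comp PolyTime.fst))).wordEq
            (PolyTime.snd.comp (PolyTime.snd.comp PolyTime.snd)))
          (hR.comp
            ((PolyTime.fst.comp (PolyTime.snd.comp (PolyTime.snd.comp PolyTime.fst))).pair
              (PolyTime.fst.comp (PolyTime.snd.comp PolyTime.snd)))))))
    (PolyTime.rule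
      (PolyTime.some (PolyTime.fst.comp (PolyTime.snd.comp (PolyTime.snd.comp PolyTime.fst))))
      (PolyTime.cons (PolyTime.nonterminal (PolyTime.fst.comp (PolyTime.snd.comp PolyTime.snd)))
        (PolyTime.const [])))

theorem PolyTime.tail {f : β → List α} (hf : PolyTime α f) : PolyTime α fun b => (f b).tail :=
  PolyTime.comp (g := List.tail) (PolyTime.of_expr (fun k => .tl (.var k)) (2 * .X)
    fun k s w h => by
      cases w with
      | nil =>
        have h : s k = .nil := h
        simp [Expr.eval, Expr.cost, h, Tree.right, Tree.size]
        rfl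
      | cons a w =>
        have h : s k = .node (.atom a) (Enc.enc w) := h
        simp [Expr.eval, Expr.cost, h, Tree.right, Tree.size]
        simp [esize]
        omega) hf

theorem polyTime_letterRules : PolyTime α (letterRules (α := α)) :=
  PolyTime.map (g := fun (_ : List (List α)) (t : Occurrence α) =>
    (⟨.some t.2.1, t.2.1.map .terminal⟩ : HatRule α))
    (PolyTime.filter (g := fun _ t => decide (t.2.1.tail = [])) polyTime_occurrences
      ((PolyTime.tail (PolyTime.fst.comp (PolyTime.snd.comp PolyTime.snd))).wordEq
        (PolyTime.const [])))
    (PolyTime.rule (PolyTime.some (PolyTime.fst.comp (PolyTime.snd.comp PolyTime.snd)))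
      (PolyTime.terminals (PolyTime.fst.comp (PolyTime.snd.comp PolyTime.snd))))

theorem polyTime_startRules : PolyTime α (startRules (α := α)) :=
  PolyTime.map (g := fun (_ : List (List α)) (w : List α) =>
    (⟨none, if decide (w = []) then [] else [.nonterminal (.some w)]⟩ : HatRule α))
    PolyTime.id
    (PolyTime.rule (PolyTime.const none)
      (PolyTime.ite (PolyTime.snd.wordEq (PolyTime.const [])) (PolyTime.const [])
        (PolyTime.cons (PolyTime.nonterminal PolyTime.snd) (PolyTime.const []))))

theorem mem_branchRules (l : List (List α)) (ρ : HatRule α) :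
    ρ ∈ branchRules l ↔ ∃ x y, x ∈ factors l.toFinset ∧ y ∈ factors l.toFinset ∧
      x ++ y ∈ factors l.toFinset ∧
      ρ = ⟨.some (x ++ y), [.nonterminal (.some x), .nonterminal (.some y)]⟩ := by
  simp only [branchRules, List.mem_flatMap, List.mem_map, List.mem_filter, mem_splits,
    mem_occurrences, mem_factors, List.mem_toFinset]
  constructor
  · rintro ⟨⟨u, z, v⟩, ⟨-, h⟩, ⟨x, y⟩, ⟨rfl, hne⟩, rfl⟩
    simp only [Bool.and_eq_true, Bool.not_eq_true', decide_eq_false_iff_not] at hne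
    refine ⟨x, y, ⟨hne.1, u, y ++ v, ?_⟩, ⟨hne.2, u ++ x, v, ?_⟩, ⟨by simp [hne], u, v, h⟩, rfl⟩ <;>
    simpa using h
  · rintro ⟨x, y, ⟨hx, -⟩, ⟨hy, -⟩, ⟨hxy, u, v, h⟩, rfl⟩
    exact ⟨(u, x ++ y, v), ⟨hxy, h⟩, (x, y), ⟨rfl, by simp [hx, hy]⟩, rfl⟩

/-- A common context of `x` and `y` in the sample is a pair of occurrences of `x` and `y` with equal
context components, which is what the filter tests. -/
theorem mem_unitRules {r : List α → List α → Prop} {R : List α × List α → Bool}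
    (hR : ∀ x y, R (x, y) = true ↔ r x y) (l : List (List α))
    (ρ : HatRule α) :
    ρ ∈ unitRules R l ↔ ∃ x y, x ∈ factors l.toFinset ∧ y ∈ factors l.toFinset ∧ r x y ∧
      (dist (l.toFinset : Set (List α)) x ∩ dist (l.toFinset : Set (List α)) y).Nonempty ∧
      ρ = ⟨.some x, [.nonterminal (.some y)]⟩ := by
  simp only [unitRules, List.mem_flatMap, List.mem_map, List.mem_filter,
    mem_occurrences, mem_factors, List.mem_toFinset, Bool.and_eq_true, decide_eq_true_eq, hR]
  constructor
  · rintro ⟨⟨u, x, v⟩, ⟨hx, h⟩, ⟨u', y, v'⟩, ⟨⟨hy, h'⟩, hu, hv, hr⟩, rfl⟩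
    simp only at hx h hy h' hu hv hr
    subst hu hv
    exact ⟨x, y, ⟨hx, u, v, h⟩, ⟨hy, u, v, h'⟩, hr,
      ⟨(u, v), by simpa [dist] using h, by simpa [dist] using h'⟩, rfl⟩
  · rintro ⟨x, y, ⟨hx, -⟩, ⟨hy, -⟩, hr, ⟨⟨u, v⟩, h, h'⟩, rfl⟩
    simp only [dist, Set.mem_ofPred_eq, List.coe_toFinset] at h h'
    exact ⟨(u, x, v), ⟨hx, h⟩, (u, y, v), ⟨⟨hy, h'⟩, rfl, rfl, hr⟩, rfl⟩

/-- Occurrences are nonempty, so an empty tail singles out the one-letter factors. -/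
theorem mem_letterRules (l : List (List α)) (ρ : HatRule α) :
    ρ ∈ letterRules l ↔ ∃ a, [a] ∈ factors l.toFinset ∧ ρ = ⟨.some [a], [.terminal a]⟩ := by
  simp only [letterRules, List.mem_map, List.mem_filter, mem_occurrences, mem_factors,
    List.mem_toFinset, decide_eq_true_eq]
  constructor
  · rintro ⟨⟨u, x, v⟩, ⟨⟨hx, h⟩, ht⟩, rfl⟩
    cases x with
    | nil => exact absurd rfl hx
    | cons a x =>
      obtain rfl : x = [] := ht
      exact ⟨a, ⟨hx, u, v, h⟩, rfl⟩
  · rintro ⟨a, ⟨ha, u, v, h⟩, rfl⟩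
    exact ⟨(u, [a], v), ⟨⟨ha, h⟩, rfl⟩, rfl⟩

theorem mem_startRules (l : List (List α)) (ρ : HatRule α) :
    ρ ∈ startRules l ↔ ∃ w ∈ l.toFinset, ρ = ⟨none, bracket w⟩ := by
  have : ∀ w : List α, bracket w =
      if decide (w = []) then [] else [.nonterminal (.some w)] := by
    intro w
    cases w <;> simp [bracket]
  simp only [startRules, List.mem_map, List.mem_toFinset, this, eq_comm]

theorem mem_hatGrammar_rules [Fintype α] {r : List α → List α → Prop} {K : Finset (List α)}
    {ρ : HatRule α} : ρ ∈ (hatGrammar r K).rules ↔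
      (∃ x y, x ∈ factors K ∧ y ∈ factors K ∧ x ++ y ∈ factors K ∧
        ρ = ⟨.some (x ++ y), [.nonterminal (.some x), .nonterminal (.some y)]⟩) ∨
      (∃ x y, x ∈ factors K ∧ y ∈ factors K ∧ r x y ∧
        (dist (K : Set (List α)) x ∩ dist (K : Set (List α)) y).Nonempty ∧
        ρ = ⟨.some x, [.nonterminal (.some y)]⟩) ∨
      (∃ a, [a] ∈ factors K ∧ ρ = ⟨.some [a], [.terminal a]⟩) ∨
      ∃ w ∈ K, ρ = ⟨none, bracket w⟩ := by
  simp only [hatGrammar, Finset.mem_union, Finset.mem_image, Finset.mem_filter, Finset.mem_product,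
    Prod.exists, Finset.mem_univ, true_and, or_assoc, and_assoc, eq_comm]

/-- Total length does not see the empty word. A nonempty word contributes `2 * |w| + 2 ≤ 4 * |w|` to
the encoding, and since there are no repetitions the empty word contributes at most once, adding `2`
to the final leaf. -/
theorem esize_le_of_nodup {l : List (List α)} (h : l.Nodup) :
    esize α l ≤ 4 * ∑ w ∈ l.toFinset, w.length + 3 := by
  have h1 : ∀ l : List (List α), l.Nodup → [] ∉ l →
      esize α l ≤ 4 * (l.map fun w => w.length).sum + 1 := by
    intro l
    induction l with
    | nil => simp
    | cons w l ih =>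
      intro hl hw
      simp only [List.nodup_cons, List.mem_cons, not_or] at hl hw
      have := ih hl.2 hw.2
      have := List.length_pos_iff.2 (Ne.symm hw.1)
      rw [esize_cons, esize_word]
      simp
      omega
  rw [List.sum_toFinset _ h]
  by_cases hl : [] ∈ l
  · have hp := List.perm_cons_erase hl
    have h2 := h1 (l.erase []) (h.erase _) (fun h' => (List.Nodup.mem_erase_iff h).1 h' |>.1 rfl)
    have h3 : ∀ l l' : List (List α), l.Perm l' → esize α l = esize α l' := by
      intro l l' h
      induction h with
      | nil => rfl
      | cons _ _ ih => simp [ih]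
      | swap => simp; omega
      | trans _ _ h h' => exact h.trans h'
    rw [h3 _ _ hp, (hp.map fun w => w.length).sum_eq, esize_cons, esize_word]
    simp
    omega
  · have := h1 l h hl
    omega

theorem polyTimeLearner_hatGrammar [Fintype α] {r : List α → List α → Prop}
    {R : List α × List α → Bool} (hR : PolyTime α R) (hr : ∀ x y, R (x, y) = true ↔ r x y) :
    PolyTimeLearner (hatGrammar r) := by
  have h1 : PolyTime α fun l : List (List α) =>
      none :: (occurrences l).map fun t => Option.some t.2.1 :=
    PolyTime.cons (PolyTime.const none) (PolyTime.map (g := fun _ t => Option.some t.2.1)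
      polyTime_occurrences (PolyTime.some (PolyTime.fst.comp (PolyTime.snd.comp PolyTime.snd))))
  have h2 := PolyTime.append polyTime_branchRules (PolyTime.append (polyTime_unitRules hR)
    (PolyTime.append polyTime_letterRules polyTime_startRules))
  obtain ⟨c, p, hc⟩ := h1.pair h2
  refine ⟨c 0, p.comp (4 * .X + 3), fun K l hl hK => ?_⟩
  subst hK
  obtain ⟨⟨n, hn, hexec⟩, -⟩ := hc 0 (inputStore (encList encWord l)) l rfl fun j hj => by
    simp [inputStore, Nat.pos_iff_ne_zero.1 hj]
  refine ⟨n, _, _, _, hexec, hn.trans ?_, update_self .., fun X => ?_, fun ρ => ?_⟩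
  · rw [Polynomial.eval_comp]
    refine polynomial_eval_mono p ?_
    simpa using esize_le_of_nodup hl
  · simp only [hatGrammar, List.mem_cons, List.mem_map, mem_occurrences, Finset.mem_insert,
      Finset.mem_image, mem_factors, List.mem_toFinset, Prod.exists]
    refine or_congr_right ⟨?_, ?_⟩
    · rintro ⟨u, x, v, ⟨hx, h⟩, rfl⟩
      exact ⟨x, ⟨hx, u, v, h⟩, rfl⟩
    · rintro ⟨x, ⟨hx, u, v, h⟩, rfl⟩
      exact ⟨u, x, v, ⟨hx, h⟩, rfl⟩
  · rw [mem_hatGrammar_rules, List.mem_append, List.mem_append, List.mem_append, mem_branchRules,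
      mem_unitRules hr, mem_letterRules, mem_startRules]

end Learner

/-! ### Derivations -/

/-- `Expands G γ w`: the word `w` is derived from the sentential form `γ`. -/
inductive Expands {α : Type} (G : ContextFreeGrammar α) :
    List (Symbol α G.NT) → List α → Prop
  | nil : Expands G [] []
  | terminal (a : α) {γ : List (Symbol α G.NT)} {w : List α} (h : Expands G γ w) :
      Expands G (.terminal a :: γ) (a :: w)
  | nonterminal {ρ : ContextFreeRule α G.NT} (hρ : ρ ∈ G.rules) {γ : List (Symbol α G.NT)}
      {u v : List α} (hu : Expands G ρ.output u) (hv : Expands G γ v) :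
      Expands G (.nonterminal ρ.input :: γ) (u ++ v)

section Expands

variable {α : Type} {G : ContextFreeGrammar α}

theorem Expands.append {γ δ : List (Symbol α G.NT)} {u v : List α} (hu : Expands G γ u)
    (hv : Expands G δ v) : Expands G (γ ++ δ) (u ++ v) := by
  induction hu with
  | nil => exact hv
  | terminal a _ ih => exact .terminal a ih
  | nonterminal hρ hu _ _ ih => simpa using Expands.nonterminal hρ hu ih

theorem Expands.exists_of_append {γ δ : List (Symbol α G.NT)} {w : List α}
    (h : Expands G (γ ++ δ) w) : ∃ u v, Expands G γ u ∧ Expands G δ v ∧ w = u ++ v := by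
  induction γ generalizing w with
  | nil => exact ⟨[], w, .nil, h, rfl⟩
  | cons X γ ih =>
    cases h with
    | terminal a h =>
      obtain ⟨u, v, hu, hv, rfl⟩ := ih h
      exact ⟨a :: u, v, .terminal a hu, hv, rfl⟩
    | nonterminal hρ hx h =>
      obtain ⟨u, v, hu, hv, rfl⟩ := ih h
      exact ⟨_, v, .nonterminal hρ hx hu, hv, by simp⟩

theorem expands_terminals (w : List α) : Expands G (w.map .terminal) w := by
  induction w with
  | nil => exact .nil
  | cons a w ih => exact .terminal a ih

theorem Expands.single {ρ : ContextFreeRule α G.NT} (hρ : ρ ∈ G.rules) {u : List α}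
    (hu : Expands G ρ.output u) : Expands G [.nonterminal ρ.input] u := by
  simpa using Expands.nonterminal hρ hu .nil

theorem Expands.exists_rule {A : G.NT} {w : List α} (h : Expands G [.nonterminal A] w) :
    ∃ ρ ∈ G.rules, ρ.input = A ∧ Expands G ρ.output w := by
  cases h with
  | nonterminal hρ hu hv =>
    cases hv
    exact ⟨_, hρ, rfl, by simpa using hu⟩

theorem Expands.derives {γ : List (Symbol α G.NT)} {w : List α} (h : Expands G γ w) :
    G.Derives γ (w.map .terminal) := by
  induction h with
  | nil => rfl
  | terminal a _ ih => exact ih.append_left [.terminal a]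
  | @nonterminal ρ hρ γ u v _ _ ihu ihv =>
    have h1 : G.Produces (.nonterminal ρ.input :: γ) (ρ.output ++ γ) := ⟨ρ, hρ, .head γ⟩
    refine h1.trans_derives ((ihu.append_right γ).trans ?_)
    rw [List.map_append]
    exact ihv.append_left _

/-- Undoing a rewriting step regroups the part of the word coming from `ρ.output` under `ρ.input`.
Iterated, it turns a sequence of rewriting steps into a structural derivation, on which induction is
possible. -/
theorem Expands.of_produces {γ δ : List (Symbol α G.NT)} {w : List α} (h : G.Produces γ δ)
    (hw : Expands G δ w) : Expands G γ w := by
  obtain ⟨ρ, hρ, hr⟩ := h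
  obtain ⟨p, q, rfl, rfl⟩ := hr.exists_parts
  obtain ⟨u, v, hu, hv, rfl⟩ := hw.exists_of_append
  obtain ⟨u, x, hp, hx, rfl⟩ := hu.exists_of_append
  exact (hp.append (.single hρ hx)).append hv

theorem Expands.of_derives {γ δ : List (Symbol α G.NT)} {w : List α} (h : G.Derives γ δ)
    (hw : Expands G δ w) : Expands G γ w := by
  induction h using Relation.ReflTransGen.head_induction_on with
  | refl => exact hw
  | head h _ ih => exact ih.of_produces h

theorem mem_yields {γ : List (Symbol α G.NT)} {w : List α} : w ∈ yields G γ ↔ Expands G γ w :=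
  ⟨fun h => (expands_terminals w).of_derives h, Expands.derives⟩

theorem mem_language_iff_expands {w : List α} :
    w ∈ G.language ↔ Expands G [.nonterminal G.initial] w :=
  mem_yields (G := G) (γ := [.nonterminal G.initial])

end Expands

/-! ### Derivations of the hypothesis grammar -/

/-- The derivation relation of `Ĝ(K)`. -/
def HatDerives {α : Type} [DecidableEq α] [Fintype α] (r : List α → List α → Prop)
    (K : Finset (List α)) : List (Symbol α (Option (List α))) →
      List (Symbol α (Option (List α))) → Prop :=
  (hatGrammar r K).toCFG.Derives

theorem bracket_of_ne_nil {α : Type} {w : List α} (h : w ≠ []) : bracket w = [.nonterminal (some w)] := by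
  cases w with
  | nil => exact absurd rfl h
  | cons a w => rfl

/-- The word obtained from a sentential form of `Ĝ(K)` by replacing `[x]` by `x`. -/
def unbracket {α : Type} (β : List (Symbol α (Option (List α)))) : List α :=
  β.flatMap fun
    | .terminal a => [a]
    | .nonterminal none => []
    | .nonterminal (some x) => x

@[simp] theorem unbracket_append {α : Type} (β γ : List (Symbol α (Option (List α)))) :
    unbracket (β ++ γ) = unbracket β ++ unbracket γ := by
  simp [unbracket]

@[simp] theorem unbracket_terminals {α : Type} (w : List α) : unbracket (w.map .terminal) = w := by
  induction w with
  | nil => rfl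
  | cons a w ih => simpa [unbracket] using ih

@[simp] theorem unbracket_bracket {α : Type} (w : List α) : unbracket (bracket w) = w := by
  cases w <;> simp [unbracket, bracket]

section Hat

variable {α : Type} [DecidableEq α] [Fintype α] {r : List α → List α → Prop}
  {K : Finset (List α)}

theorem HatDerives.trans {β γ δ : List (Symbol α (Option (List α)))} (h : HatDerives r K β γ)
    (h' : HatDerives r K γ δ) : HatDerives r K β δ :=
  Relation.ReflTransGen.trans h h'

theorem HatDerives.refl (β : List (Symbol α (Option (List α)))) : HatDerives r K β β :=
  Relation.ReflTransGen.refl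

theorem HatDerives.append {β β' γ γ' : List (Symbol α (Option (List α)))}
    (h : HatDerives r K β β') (h' : HatDerives r K γ γ') :
    HatDerives r K (β ++ γ) (β' ++ γ') :=
  (ContextFreeGrammar.Derives.append_right (g := (hatGrammar r K).toCFG) h γ).trans
    (ContextFreeGrammar.Derives.append_left (g := (hatGrammar r K).toCFG) h' β')

theorem HatDerives.of_rule {ρ : ContextFreeRule α (Option (List α))}
    (h : ρ ∈ (hatGrammar r K).rules) : HatDerives r K [.nonterminal ρ.input] ρ.output :=
  Relation.ReflTransGen.single ⟨ρ, h, .input_output⟩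

theorem HatDerives.branch {x y : List α} (hx : x ≠ []) (hy : y ≠ []) {c : List α × List α}
    (h : c.1 ++ (x ++ y) ++ c.2 ∈ K) :
    HatDerives r K [.nonterminal (some (x ++ y))]
      ([.nonterminal (some x)] ++ [.nonterminal (some y)]) := by
  refine of_rule (ρ := ⟨some (x ++ y), _⟩) (mem_hatGrammar_rules.2 (.inl ⟨x, y, ?_, ?_, ?_, rfl⟩))
  · exact (mem_factors K x).2 ⟨hx, c.1, y ++ c.2, by simpa using h⟩
  · exact (mem_factors K y).2 ⟨hy, c.1 ++ x, c.2, by simpa using h⟩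
  · exact (mem_factors K _).2 ⟨by simp [hx], c.1, c.2, h⟩

theorem HatDerives.unit {x y : List α} (hx : x ≠ []) (hy : y ≠ []) (hxy : r x y)
    {c : List α × List α} (h : c.1 ++ x ++ c.2 ∈ K) (h' : c.1 ++ y ++ c.2 ∈ K) :
    HatDerives r K [.nonterminal (some x)] [.nonterminal (some y)] :=
  of_rule (ρ := ⟨some x, _⟩) (mem_hatGrammar_rules.2 (.inr (.inl ⟨x, y,
    (mem_factors K x).2 ⟨hx, c.1, c.2, h⟩, (mem_factors K y).2 ⟨hy, c.1, c.2, h'⟩, hxy,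
    ⟨c, h, h'⟩, rfl⟩)))

theorem HatDerives.letter {a : α} (h : [a] ∈ factors K) :
    HatDerives r K [.nonterminal (some [a])] [.terminal a] :=
  of_rule (ρ := ⟨some [a], _⟩) (mem_hatGrammar_rules.2 (.inr (.inr (.inl ⟨a, h, rfl⟩))))

theorem HatDerives.start {w : List α} (h : w ∈ K) :
    HatDerives r K [.nonterminal none] (bracket w) :=
  of_rule (ρ := ⟨none, _⟩) (mem_hatGrammar_rules.2 (.inr (.inr (.inr ⟨w, h, rfl⟩))))

/-- Split off the first letter repeatedly: all suffixes and letters of `x` are factors of the same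
word of `K`. -/
theorem HatDerives.word {x : List α} (hx : x ≠ []) {c : List α × List α}
    (h : c.1 ++ x ++ c.2 ∈ K) : HatDerives r K [.nonterminal (some x)] (x.map .terminal) := by
  induction x generalizing c with
  | nil => exact absurd rfl hx
  | cons a x ih =>
    have ha : [a] ∈ factors K :=
      (mem_factors K _).2 ⟨by simp, c.1, x ++ c.2, by simpa using h⟩
    by_cases hx' : x = []
    · subst hx'
      exact letter ha
    · have hb : HatDerives r K [.nonterminal (some ([a] ++ x))] _ := branch (by simp) hx' (c := c) h
      exact hb.trans ((letter ha).append (ih hx' (c := (c.1 ++ [a], c.2)) (by simpa using h)))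

theorem mem_hatGrammar_language {w : List α} :
    w ∈ (hatGrammar r K).language ↔ HatDerives r K [.nonterminal none] (w.map .terminal) :=
  Iff.rfl

theorem subset_hatGrammar_language {w : List α} (h : w ∈ K) : w ∈ (hatGrammar r K).language := by
  rw [mem_hatGrammar_language]
  refine (HatDerives.start h).trans ?_
  by_cases hw : w = []
  · subst hw
    exact .refl _
  · rw [bracket_of_ne_nil hw]
    exact HatDerives.word hw (c := ([], [])) (by simpa using h)

/-- The soundness invariant. Branching and letter rules do not change the unbracketed word. A unit
rule `[x] → [y]` exchanges `x` and `y`, which have a common context in `K ⊆ L` and hence equal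
distributions in `L`. The start symbol never returns, so its rule applies only at the beginning. -/
theorem Substitutable.unbracket_mem_of_rewrites {L : Language α} (hL : Substitutable r L)
    (hK : ∀ w ∈ K, w ∈ L) {ρ : ContextFreeRule α (Option (List α))}
    (hρ : ρ ∈ (hatGrammar r K).rules) {β γ : List (Symbol α (Option (List α)))}
    (hr : ρ.Rewrites β γ)
    (hβ : β = [.nonterminal none] ∨ (.nonterminal none ∉ β ∧ unbracket β ∈ L)) :
    .nonterminal none ∉ γ ∧ unbracket γ ∈ L := by
  obtain ⟨p, q, rfl, rfl⟩ := hr.exists_parts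
  rcases hβ with h | ⟨hn, hm⟩
  · obtain ⟨rfl, hin, rfl⟩ : p = [] ∧ ρ.input = none ∧ q = [] := by
      cases p <;> simp_all
    rcases mem_hatGrammar_rules.1 hρ with ⟨x, y, -, -, -, rfl⟩ | ⟨x, y, -, -, -, -, rfl⟩ |
      ⟨a, -, rfl⟩ | ⟨w, hw, rfl⟩
    · cases hin
    · cases hin
    · cases hin
    · refine ⟨?_, by simpa using hK w hw⟩
      cases w <;> simp [bracket]
  · simp only [List.mem_append, not_or, List.mem_singleton] at hn
    rw [unbracket_append, unbracket_append] at hm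
    rcases mem_hatGrammar_rules.1 hρ with ⟨x, y, -, -, -, rfl⟩ | ⟨x, y, -, -, hxy, hd, rfl⟩ |
      ⟨a, -, rfl⟩ | ⟨w, hw, rfl⟩
    · exact ⟨by simp [hn.1.1, hn.2], by simpa [unbracket] using hm⟩
    · refine ⟨by simp [hn.1.1, hn.2], ?_⟩
      have hd' : (dist L x ∩ dist L y).Nonempty :=
        hd.mono fun c hc => ⟨hK _ hc.1, hK _ hc.2⟩
      have hm : unbracket p ++ x ++ unbracket q ∈ L := by simpa [unbracket] using hm
      have h1 : (unbracket p, unbracket q) ∈ dist L x := hm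
      rw [hL x y ⟨hd', hxy⟩] at h1
      have h2 : unbracket p ++ y ++ unbracket q ∈ L := h1
      simpa [unbracket] using h2
    · exact ⟨by simp [hn.1.1, hn.2], by simpa [unbracket] using hm⟩
    · exact absurd rfl hn.1.2

theorem Substitutable.hatGrammar_sound {L : Language α} (hL : Substitutable r L)
    (hK : ∀ w ∈ K, w ∈ L) {w : List α} (hw : w ∈ (hatGrammar r K).language) : w ∈ L := by
  have key : ∀ β : List (Symbol α (Option (List α))), HatDerives r K [.nonterminal none] β →
      β = [.nonterminal none] ∨ (.nonterminal none ∉ β ∧ unbracket β ∈ L) := by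
    intro β h
    induction h with
    | refl => exact .inl rfl
    | tail _ hp ih =>
      obtain ⟨ρ, hρ, hr⟩ := hp
      exact .inr (hL.unbracket_mem_of_rewrites hK hρ hr ih)
  have h : (w.map .terminal : List (Symbol α (Option (List α)))) = [.nonterminal none] ∨ _ :=
    key _ hw
  rcases h with h | ⟨-, h⟩
  · cases w with
    | nil => cases h
    | cons a w => cases h
  · rwa [unbracket_terminals] at h

end Hat

/-! ### Characteristic sets of polynomial cardinality -/

section CharacteristicSet

variable {α : Type}

open Classical in
/-- A nonempty word derived from `γ` that `φ` maps to `m`; the empty word if there is none. -/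
noncomputable def typedWord {M : Type} (G : ContextFreeGrammar α) (φ : List α → M)
    (γ : List (Symbol α G.NT)) (m : M) : List α :=
  if h : ∃ w, w ≠ [] ∧ Expands G γ w ∧ φ w = m then h.choose else []

theorem typedWord_spec {M : Type} {G : ContextFreeGrammar α} (φ : List α → M)
    {γ : List (Symbol α G.NT)} {w : List α} (hw : w ≠ []) (h : Expands G γ w) :
    typedWord G φ γ (φ w) ≠ [] ∧ Expands G γ (typedWord G φ γ (φ w)) ∧
      φ (typedWord G φ γ (φ w)) = φ w := by
  have h' : ∃ u, u ≠ [] ∧ Expands G γ u ∧ φ u = φ w := ⟨w, hw, h, rfl⟩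
  rw [typedWord, dif_pos h']
  exact h'.choose_spec

theorem typedWord_nil {M : Type} (G : ContextFreeGrammar α) (φ : List α → M) (m : M) :
    typedWord G φ [] m = [] := by
  rw [typedWord, dif_neg]
  rintro ⟨w, hw, h, -⟩
  cases h
  exact hw rfl

/-- `c` is a context of everything derived from `γ`. -/
def IsContextOf (G : ContextFreeGrammar α) (γ : List (Symbol α G.NT)) (c : List α × List α) :
    Prop :=
  ∀ v, Expands G γ v → c.1 ++ v ++ c.2 ∈ G.language

open Classical in
/-- A context of everything derived from the form, if there is one; the empty context for `none`. -/
noncomputable def commonContext (G : ContextFreeGrammar α) :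
    Option (List (Symbol α G.NT)) → List α × List α
  | none => ([], [])
  | some γ => if h : ∃ c, IsContextOf G γ c then h.choose else ([], [])

theorem commonContext_spec {G : ContextFreeGrammar α} {γ : List (Symbol α G.NT)}
    {c : List α × List α} (h : IsContextOf G γ c) :
    IsContextOf G γ (commonContext G (some γ)) := by
  have h' : ∃ c, IsContextOf G γ c := ⟨c, h⟩
  rw [commonContext, dif_pos h']
  exact h'.choose_spec

open Classical in
/-- The start symbol, the letters, and the suffixes of the right-hand sides. -/
noncomputable def ruleSuffixes [Fintype α] (G : ContextFreeGrammar α) :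
    Finset (List (Symbol α G.NT)) :=
  insert [] (insert [.nonterminal G.initial] ((Finset.univ.image fun a : α => [.terminal a]) ∪
    G.rules.biUnion fun ρ => ρ.output.tails.toFinset))

/-- A right-hand side `β` has `|β| + 1` suffixes, exactly its contribution to the grammar size. -/
theorem card_ruleSuffixes_le [Fintype α] (G : ContextFreeGrammar α) :
    (ruleSuffixes G).card ≤ grammarSize G + Fintype.card α + 2 := by
  classical
  have h1 : (Finset.univ.image fun a : α => ([.terminal a] : List (Symbol α G.NT))).card ≤
      Fintype.card α := Finset.card_image_le
  have h2 : (G.rules.biUnion fun ρ => ρ.output.tails.toFinset).card ≤ grammarSize G :=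
    Finset.card_biUnion_le.trans <| Finset.sum_le_sum fun ρ _ =>
      (List.toFinset_card_le _).trans (by simp)
  refine (Finset.card_insert_le _ _).trans ?_
  have h3 := Finset.card_insert_le [.nonterminal G.initial]
    ((Finset.univ.image fun a : α => ([.terminal a] : List (Symbol α G.NT))) ∪
      G.rules.biUnion fun ρ => ρ.output.tails.toFinset)
  have h4 := Finset.card_union_le
    (Finset.univ.image fun a : α => ([.terminal a] : List (Symbol α G.NT)))
    (G.rules.biUnion fun ρ => ρ.output.tails.toFinset)
  omega

theorem nil_mem_ruleSuffixes [Fintype α] (G : ContextFreeGrammar α) : [] ∈ ruleSuffixes G := by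
  simp [ruleSuffixes]

theorem initial_mem_ruleSuffixes [Fintype α] (G : ContextFreeGrammar α) :
    [.nonterminal G.initial] ∈ ruleSuffixes G := by
  simp [ruleSuffixes]

theorem letter_mem_ruleSuffixes [Fintype α] (G : ContextFreeGrammar α) (a : α) :
    [.terminal a] ∈ ruleSuffixes G := by
  simp [ruleSuffixes]

theorem output_mem_ruleSuffixes [Fintype α] {G : ContextFreeGrammar α}
    {ρ : ContextFreeRule α G.NT} (hρ : ρ ∈ G.rules) : ρ.output ∈ ruleSuffixes G := by
  simp only [ruleSuffixes, Finset.mem_insert, Finset.mem_union, Finset.mem_biUnion,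
    List.mem_toFinset, List.mem_tails]
  exact .inr (.inr (.inr ⟨ρ, hρ, List.suffix_rfl⟩))

theorem tail_mem_ruleSuffixes [Fintype α] {G : ContextFreeGrammar α} {X : Symbol α G.NT}
    {γ : List (Symbol α G.NT)} (h : X :: γ ∈ ruleSuffixes G) : γ ∈ ruleSuffixes G := by
  have h0 := nil_mem_ruleSuffixes G
  simp only [ruleSuffixes, Finset.mem_insert, Finset.mem_union, Finset.mem_biUnion,
    List.mem_toFinset, List.mem_tails, Finset.mem_image, Finset.mem_univ, true_and] at h
  rcases h with h | h | ⟨a, h⟩ | ⟨ρ, hρ, h⟩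
  · cases h
  · injection h with _ h
    rwa [h]
  · injection h with _ h
    rwa [← h]
  · simp only [ruleSuffixes, Finset.mem_insert, Finset.mem_union, Finset.mem_biUnion,
      List.mem_toFinset, List.mem_tails]
    exact .inr (.inr (.inr ⟨ρ, hρ, (List.suffix_cons X γ).trans h⟩))

open Classical in
/-- The words of the language that consist of two typed words in a common context. -/
noncomputable def typedSample [Fintype α] {M : Type} [Fintype M] (G : ContextFreeGrammar α)
    (φ : List α → M) : Finset (List α) :=
  ((insert none ((ruleSuffixes G).image some) ×ˢ ((ruleSuffixes G ×ˢ Finset.univ) ×ˢ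
    (ruleSuffixes G ×ˢ Finset.univ))).image fun t =>
      (commonContext G t.1).1 ++ (typedWord G φ t.2.1.1 t.2.1.2 ++ typedWord G φ t.2.2.1 t.2.2.2) ++
        (commonContext G t.1).2).filter (· ∈ G.language)

theorem card_typedSample_le [Fintype α] {M : Type} [Fintype M] (G : ContextFreeGrammar α)
    (φ : List α → M) : (typedSample G φ).card ≤
      (grammarSize G + Fintype.card α + 3) * (((grammarSize G + Fintype.card α + 2) *
        Fintype.card M) * ((grammarSize G + Fintype.card α + 2) * Fintype.card M)) := by
  classical
  refine (Finset.card_filter_le _ _).trans (Finset.card_image_le.trans ?_)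
  rw [Finset.card_product, Finset.card_product, Finset.card_product, Finset.card_univ]
  have h1 := card_ruleSuffixes_le G
  have h2 : (insert none ((ruleSuffixes G).image some)).card ≤
      grammarSize G + Fintype.card α + 3 :=
    (Finset.card_insert_le _ _).trans (by
      have := Finset.card_image_le (s := ruleSuffixes G) (f := some)
      omega)
  gcongr

theorem mem_typedSample [Fintype α] {M : Type} [Fintype M] {G : ContextFreeGrammar α}
    {φ : List α → M} {o : Option (List (Symbol α G.NT))} (ho : ∀ γ ∈ o, γ ∈ ruleSuffixes G)
    {δ δ' : List (Symbol α G.NT)} (hδ : δ ∈ ruleSuffixes G) (hδ' : δ' ∈ ruleSuffixes G) (m m' : M)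
    (h : (commonContext G o).1 ++ (typedWord G φ δ m ++ typedWord G φ δ' m') ++
      (commonContext G o).2 ∈ G.language) :
    (commonContext G o).1 ++ (typedWord G φ δ m ++ typedWord G φ δ' m') ++
      (commonContext G o).2 ∈ typedSample G φ := by
  classical
  refine Finset.mem_filter.2 ⟨Finset.mem_image.2 ⟨(o, (δ, m), (δ', m')), ?_, rfl⟩, h⟩
  refine Finset.mem_product.2 ⟨?_, Finset.mem_product.2 ⟨Finset.mem_product.2 ⟨hδ,
    Finset.mem_univ _⟩, Finset.mem_product.2 ⟨hδ', Finset.mem_univ _⟩⟩⟩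
  cases o with
  | none => exact Finset.mem_insert_self _ _
  | some γ => exact Finset.mem_insert_of_mem (Finset.mem_image_of_mem _ (ho γ rfl))

theorem mem_language_of_mem_typedSample [Fintype α] {M : Type} [Fintype M]
    {G : ContextFreeGrammar α} {φ : List α → M} {w : List α} (hw : w ∈ typedSample G φ) :
    w ∈ G.language := by
  classical
  exact (Finset.mem_filter.1 hw).2

/-- The sample controls only how many words occur, not how long they are, so representatives and
contexts may be chosen arbitrarily. Equality of `φ`-values makes the representatives equivalent, and
a context is needed only for the suffix being rewritten. -/
theorem isCharacteristic_typedSample [Fintype α] [DecidableEq α] {M : Type} [Monoid M] [Fintype M]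
    {r : List α → List α → Prop} (φ : List α → M) (hmul : ∀ u v, φ (u ++ v) = φ u * φ v)
    (hr : ∀ u v, φ u = φ v → r u v) {G : ContextFreeGrammar α}
    (hG : Substitutable r G.language) :
    IsCharacteristic (hatGrammar r) (typedSample G φ) G.language := by
  refine ⟨fun w hw => mem_language_of_mem_typedSample hw, fun K hSK hKL => ?_⟩
  have memSome : ∀ {γ}, γ ∈ ruleSuffixes G → ∀ γ' ∈ some γ, γ' ∈ ruleSuffixes G := by
    rintro γ h γ' ⟨⟩
    exact h
  have hnil := nil_mem_ruleSuffixes G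
  -- The replacement step: the representative of `γ` and a concatenation of two representatives that
  -- also derives from `γ` with the same `φ`-value are linked by a unit rule, both lying in `K` in
  -- the chosen context of `γ`.
  have swap : ∀ {γ w c δ m δ' m'}, γ ∈ ruleSuffixes G → IsContextOf G γ c → w ≠ [] →
      Expands G γ w → δ ∈ ruleSuffixes G → δ' ∈ ruleSuffixes G →
      typedWord G φ δ m ++ typedWord G φ δ' m' ≠ [] →
      Expands G γ (typedWord G φ δ m ++ typedWord G φ δ' m') →
      φ (typedWord G φ δ m ++ typedWord G φ δ' m') = φ w →
      HatDerives r K [.nonterminal (some (typedWord G φ γ (φ w)))]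
        [.nonterminal (some (typedWord G φ δ m ++ typedWord G φ δ' m'))] ∧
      (commonContext G (some γ)).1 ++ (typedWord G φ δ m ++ typedWord G φ δ' m') ++
        (commonContext G (some γ)).2 ∈ K := by
    intro γ w c δ m δ' m' hγ hc hw hexp hδ hδ' hne hexp' hφ
    obtain ⟨h1, h2, h3⟩ := typedWord_spec φ hw hexp
    have hctx := commonContext_spec hc
    -- The representative of `γ` alone is a sample word too: its second part is the representative
    -- of the empty form, which is `λ`.
    have k1 := fun h => hSK (mem_typedSample (memSome hγ) hγ hnil (φ w) 1 h)
    have k2 := hSK (mem_typedSample (memSome hγ) hδ hδ' m m' (hctx _ hexp'))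
    rw [typedWord_nil, List.append_nil] at k1
    exact ⟨HatDerives.unit h1 hne (hr _ _ (h3.trans hφ.symm)) (k1 (hctx _ h2)) k2, k2⟩
  have complete : ∀ {γ w}, Expands G γ w → γ ∈ ruleSuffixes G → ∀ c, IsContextOf G γ c →
      w ≠ [] → HatDerives r K [.nonterminal (some (typedWord G φ γ (φ w)))] (w.map .terminal) := by
    intro γ w h
    induction h with
    | nil => exact fun _ _ _ h => absurd rfl h
    | @terminal a γ v hv ih =>
      intro hγ c hc hw
      have hγ' := tail_mem_ruleSuffixes hγ
      have hexp : Expands G (.terminal a :: γ) (a :: v) := .terminal a hv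
      have ha : typedWord G φ [.terminal a] (φ [a]) = [a] := by
        obtain ⟨-, h2, -⟩ := typedWord_spec φ (w := [a]) (G := G) (by simp) (.terminal a .nil)
        generalize typedWord G φ [.terminal a] (φ [a]) = x at h2
        cases h2 with
        | terminal _ h => cases h; rfl
      have hla := letter_mem_ruleSuffixes G a
      by_cases hv0 : v = []
      · subst hv0
        obtain ⟨s1, s2⟩ := swap (δ := [.terminal a]) (m := φ [a]) (δ' := []) (m' := 1)
          hγ hc hw hexp hla hnil (by simp [ha]) (by simpa [ha, typedWord_nil] using hexp)
          (by simp [ha, typedWord_nil])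
        rw [ha, typedWord_nil] at s1 s2
        exact s1.trans (HatDerives.word (by simp) s2)
      · obtain ⟨h1, h2, h3⟩ := typedWord_spec φ hv0 hv
        obtain ⟨s1, s2⟩ := swap (δ := [.terminal a]) (m := φ [a]) (δ' := γ) (m' := φ v)
          hγ hc hw hexp hla hγ' (by simp [ha]) (by rw [ha]; exact .terminal a h2)
          (by rw [ha, hmul, h3, ← hmul]; rfl)
        rw [ha] at s1 s2
        refine (s1.trans (HatDerives.branch (by simp) h1 s2)).trans ?_
        refine HatDerives.append (HatDerives.word (x := [a]) (by simp)
          (c := ((commonContext G (some (.terminal a :: γ))).1, typedWord G φ γ (φ v) ++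
            (commonContext G (some (.terminal a :: γ))).2)) (by simpa using s2))
          (ih hγ' (c.1 ++ [a], c.2) (fun x hx => ?_) hv0)
        simpa using hc (a :: x) (.terminal a hx)
    | @nonterminal ρ hρ γ u v hu hv ihu ihv =>
      intro hγ c hc hw
      have hγ' := tail_mem_ruleSuffixes hγ
      have hρ' := output_mem_ruleSuffixes hρ
      have hexp : Expands G (.nonterminal ρ.input :: γ) (u ++ v) := .nonterminal hρ hu hv
      -- The actual word of the other part fills the gap, so each part inherits a context.
      have hcu : IsContextOf G ρ.output (c.1, v ++ c.2) := fun x hx => by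
        simpa using hc (x ++ v) (.nonterminal hρ hx hv)
      have hcv : IsContextOf G γ (c.1 ++ u, c.2) := fun x hx => by
        simpa using hc (u ++ x) (.nonterminal hρ hu hx)
      -- There is no nonterminal for `λ`. If one part derives `λ`, the unit rule leads straight to
      -- the representative of the other part and no branching takes place.
      by_cases hu0 : u = []
      · subst hu0
        rw [List.nil_append] at hw hexp ⊢
        obtain ⟨h1, h2, h3⟩ := typedWord_spec φ hw hv
        obtain ⟨s1, -⟩ := swap (δ := γ) (m := φ v) (δ' := []) (m' := 1)
          hγ hc hw hexp hγ' hnil (by simp [h1])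
          (by simpa [typedWord_nil] using Expands.nonterminal hρ hu h2)
          (by simp [h3, typedWord_nil])
        rw [typedWord_nil, List.append_nil] at s1
        exact s1.trans (ihv hγ' _ hcv hw)
      by_cases hv0 : v = []
      · subst hv0
        rw [List.append_nil] at hw hexp ⊢
        obtain ⟨h1, h2, h3⟩ := typedWord_spec φ hw hu
        obtain ⟨s1, -⟩ := swap (δ := ρ.output) (m := φ u) (δ' := []) (m' := 1)
          hγ hc hw hexp hρ' hnil (by simp [h1])
          (by simpa [typedWord_nil] using Expands.nonterminal hρ h2 hv)
          (by simp [h3, typedWord_nil])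
        rw [typedWord_nil, List.append_nil] at s1
        exact s1.trans (ihu hρ' _ hcu hw)
      obtain ⟨h1, h2, h3⟩ := typedWord_spec φ hu0 hu
      obtain ⟨h1', h2', h3'⟩ := typedWord_spec φ hv0 hv
      obtain ⟨s1, s2⟩ := swap (δ := ρ.output) (m := φ u) (δ' := γ) (m' := φ v)
        hγ hc hw hexp hρ' hγ' (by simp [h1]) (.nonterminal hρ h2 h2')
        (by rw [hmul, h3, h3', hmul])
      rw [List.map_append]
      exact (s1.trans (HatDerives.branch h1 h1' s2)).trans
        ((ihu hρ' _ hcu hu0).append (ihv hγ' _ hcv hv0))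
  refine Set.Subset.antisymm (fun w hw => hG.hatGrammar_sound hKL hw) fun w hw => ?_
  have hw' := mem_language_iff_expands.1 hw
  have hinit := initial_mem_ruleSuffixes G
  -- With `none` as context index and only empty parts, the sample contains `λ` whenever the
  -- language does. With the start symbol as first part it contains every typed representative of
  -- the start symbol.
  by_cases hw0 : w = []
  · subst hw0
    have := fun h => hSK (mem_typedSample (φ := φ) (o := none) (by simp) hnil hnil 1 1 h)
    simp only [typedWord_nil, commonContext, List.append_nil] at this
    exact subset_hatGrammar_language (this hw)
  · obtain ⟨h1, h2, h3⟩ := typedWord_spec φ hw0 hw'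
    have := fun h =>
      hSK (mem_typedSample (φ := φ) (o := none) (by simp) hinit hnil (φ w) 1 h)
    simp only [typedWord_nil, commonContext, List.append_nil, List.nil_append] at this
    have hs := HatDerives.start (r := r) (this (mem_language_iff_expands.2 h2))
    rw [bracket_of_ne_nil h1] at hs
    exact hs.trans (complete hw' hinit ([], []) (fun v hv => by
      simpa using mem_language_iff_expands.2 hv) hw0)

theorem exists_polynomial_isCharacteristic [Fintype α] [DecidableEq α]
    {r : List α → List α → Prop} (hrefl : ∀ x, r x x) (hrec : Recognizable r) :
    ∃ q : Polynomial ℕ, ∀ G : ContextFreeGrammar α, G.language ∈ substClass r →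
      ∃ S : Finset (List α), S.card ≤ q.eval (grammarSize G) ∧
        IsCharacteristic (hatGrammar r) S G.language := by
  obtain ⟨M, _, _, h, F, hF⟩ := hrec
  have := Fintype.ofFinite M
  refine ⟨(.X + .C (Fintype.card α + 3)) * (((.X + .C (Fintype.card α + 2)) *
    .C (Fintype.card M)) * ((.X + .C (Fintype.card α + 2)) * .C (Fintype.card M))),
    fun G hG => ⟨typedSample G fun w => h (FreeMonoid.ofList w), ?_, ?_⟩⟩
  · simpa [add_assoc] using card_typedSample_le G fun w => h (FreeMonoid.ofList w)
  · refine isCharacteristic_typedSample _ (fun u v => ?_) (fun u v huv => ?_) hG.2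
    · rw [FreeMonoid.ofList_append, map_mul]
    · rw [hF, huv, ← hF]
      exact hrefl v

end CharacteristicSet

/-! ### Identification in the limit -/

section Limit

variable {α : Type} [Fintype α] [DecidableEq α] {r : List α → List α → Prop}

theorem exists_forall_subset_image {β : Type} [DecidableEq β] {w : ℕ → β} {S : Finset β}
    (h : ∀ x ∈ S, x ∈ Set.range w) : ∃ N, ∀ n ≥ N, S ⊆ (Finset.range n).image w := by
  induction S using Finset.induction_on with
  | empty => exact ⟨0, by simp⟩
  | insert x S _ ih =>
    obtain ⟨N, hN⟩ := ih fun y hy => h y (Finset.mem_insert_of_mem hy)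
    obtain ⟨i, rfl⟩ := h x (Finset.mem_insert_self _ _)
    refine ⟨max N (i + 1), fun n hn => Finset.insert_subset ?_ (hN n (by omega))⟩
    exact Finset.mem_image_of_mem _ (Finset.mem_range.2 (by omega))

theorem identifiesInLimit_image {C : Set (Language α)}
    (hC : ∀ L ∈ C, ∃ S, IsCharacteristic (hatGrammar r) S L) :
    IdentifiesInLimit (fun w n => hatGrammar r ((Finset.range n).image w)) C := by
  intro L hL w hw
  obtain ⟨S, hSL, hS⟩ := hC L hL
  obtain ⟨N, hN⟩ := exists_forall_subset_image (w := w) (S := S) fun x hx => by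
    rw [hw]
    exact hSL x hx
  refine ⟨N, fun n hn => hS _ (hN n hn) fun x hx => ?_⟩
  obtain ⟨i, -, rfl⟩ := Finset.mem_image.1 hx
  have : w i ∈ Set.range w := ⟨i, rfl⟩
  rwa [hw] at this

theorem conservativeSample_subset (w : ℕ → List α) (n : ℕ) :
    conservativeSample r w n ⊆ (Finset.range n).image w := by
  induction n with
  | zero => simp [conservativeSample]
  | succ n ih =>
    rw [conservativeSample]
    split_ifs
    · exact ih.trans (Finset.image_subset_image (Finset.range_subset_range.2 (Nat.le_succ n)))
    · exact subset_rfl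

/-- Consistency: an update puts all strings read into the sample, and without an update the old
grammar already generates the new string. -/
theorem mem_language_conservativeSample (w : ℕ → List α) {n i : ℕ} (h : i < n) :
    w i ∈ (hatGrammar r (conservativeSample r w n)).language := by
  induction n with
  | zero => omega
  | succ n ih =>
    rw [conservativeSample]
    split_ifs with hw
    · rcases Nat.lt_succ_iff_lt_or_eq.1 h with h | rfl
      · exact ih h
      · exact hw
    · exact subset_hatGrammar_language (Finset.mem_image_of_mem _ (Finset.mem_range.2 h))

theorem identifiesInLimit_conservativeSample {C : Set (Language α)}
    (hC : ∀ L ∈ C, Substitutable r L ∧ ∃ S, IsCharacteristic (hatGrammar r) S L) :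
    IdentifiesInLimit (fun w n => hatGrammar r (conservativeSample r w n)) C := by
  intro L hL w hw
  obtain ⟨hsub, S, hSL, hS⟩ := hC L hL
  obtain ⟨N, hN⟩ := exists_forall_subset_image (w := w) (S := S) fun x hx => by
    rw [hw]
    exact hSL x hx
  have hmem : ∀ i, w i ∈ L := fun i => by
    have : w i ∈ Set.range w := ⟨i, rfl⟩
    rwa [hw] at this
  have himage : ∀ n, ∀ x ∈ (Finset.range n).image w, x ∈ L := fun n x hx => by
    obtain ⟨i, -, rfl⟩ := Finset.mem_image.1 hx
    exact hmem i
  -- An update at time `n ≥ N` puts the characteristic set into the sample; the grammar is then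
  -- correct and is never replaced again. Otherwise the grammar is constant from `N` on, sound, and
  -- consistent with every string of the presentation.
  by_cases hupd : ∃ n ≥ N, w n ∉ (hatGrammar r (conservativeSample r w n)).language
  · obtain ⟨n, hn, hwn⟩ := hupd
    refine ⟨n + 1, fun m hm => ?_⟩
    induction m, hm using Nat.le_induction with
    | base =>
      simp only [conservativeSample, if_neg hwn]
      exact hS _ (hN _ (by omega)) (himage _)
    | succ m _ ih =>
      have h : w m ∈ (hatGrammar r (conservativeSample r w m)).language := by
        rw [ih]
        exact hmem m
      simp only [conservativeSample, if_pos h]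
      exact ih
  · push Not at hupd
    have hconst : ∀ n ≥ N, conservativeSample r w n = conservativeSample r w N := by
      intro n hn
      induction n, hn using Nat.le_induction with
      | base => rfl
      | succ n hn ih => rw [conservativeSample, if_pos (hupd n hn), ih]
    refine ⟨N, fun n hn => Set.Subset.antisymm (fun x hx => ?_) fun x hx => ?_⟩
    · exact hsub.hatGrammar_sound
        (fun y hy => himage n y (conservativeSample_subset w n hy)) hx
    · have hx' : x ∈ Set.range w := by rw [hw]; exact hx
      obtain ⟨i, rfl⟩ := hx'
      have := mem_language_conservativeSample (r := r) w (n := max n (i + 1)) (i := i) (by omega)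
      rw [hconst _ (by omega), ← hconst n hn] at this
      exact this

end Limit

/-! ### Least words and least contexts -/

section Least

variable {α : Type} [LinearOrder α]

/-- Words of equal length differ at a position inside both, so a common suffix does not affect the
comparison; for a plain lexicographic order this fails when one word is a prefix of the other. -/
theorem shortlex_append_right {u u' : List α} (h : List.Shortlex (· < ·) u u') (v : List α) :
    List.Shortlex (· < ·) (u ++ v) (u' ++ v) := by
  rcases List.shortlex_def.1 h with h | ⟨hlen, hlex⟩
  · exact .of_length_lt (by simpa using h)
  · refine .of_lex (by simpa using hlen) ?_
    clear h
    induction hlex with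
    | nil => simp at hlen
    | cons _ ih =>
      simp only [List.length_cons, Nat.add_right_cancel_iff] at hlen
      exact .cons (ih hlen)
    | rel h => exact .rel h

theorem shortlex_asymm {u v : List α} (h : List.Shortlex (· < ·) u v) :
    ¬ List.Shortlex (· < ·) v u :=
  Std.Asymm.asymm u v h

theorem shortlex_irrefl (u : List α) : ¬ List.Shortlex (· < ·) u u :=
  fun h => shortlex_asymm h h

theorem length_le_of_shortlex {u v : List α} (h : List.Shortlex (· < ·) u v) :
    u.length ≤ v.length := by
  rcases List.shortlex_def.1 h with h | ⟨h, -⟩ <;> omega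

theorem IsMinWord.unique {W : Set (List α)} {u v : List α} (hu : IsMinWord W u)
    (hv : IsMinWord W v) : u = v := by
  rcases hu.2 v hv.1 with h | h
  · exact h.symm
  · rcases hv.2 u hu.1 with h' | h'
    · exact h'
    · exact absurd h' (shortlex_asymm h)

theorem IsMinContext.unique {W : Set (List α × List α)} {c d : List α × List α}
    (hc : IsMinContext W c) (hd : IsMinContext W d) : c = d := by
  rcases hc.2 d hd.1 with h | h | ⟨h, h1⟩
  · exact h.symm
  · rcases hd.2 c hc.1 with h' | h' | ⟨h', -⟩
    · exact h'
    · exact absurd h' (shortlex_asymm h)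
    · rw [h'] at h
      exact absurd h (shortlex_irrefl _)
  · rcases hd.2 c hc.1 with h' | h' | ⟨-, h2⟩
    · exact h'
    · rw [h] at h'
      exact absurd h' (shortlex_irrefl _)
    · exact absurd h2 (shortlex_asymm h1)

theorem IsMinWord.length_le {W : Set (List α)} {u v : List α} (hu : IsMinWord W u) (hv : v ∈ W) :
    u.length ≤ v.length := by
  rcases hu.2 v hv with rfl | h
  · exact le_rfl
  · exact length_le_of_shortlex h

theorem IsMinContext.length_le {W : Set (List α × List α)} {c d : List α × List α}
    (hc : IsMinContext W c) (hd : d ∈ W) :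
    c.1.length + c.2.length ≤ d.1.length + d.2.length := by
  rcases hc.2 d hd with rfl | h | ⟨h, -⟩
  · exact le_rfl
  · simpa using length_le_of_shortlex h
  · simpa using (congrArg List.length h).le

theorem isMinContext_nil {W : Set (List α × List α)} (h : ([], []) ∈ W) :
    IsMinContext W ([], []) := by
  refine ⟨h, fun d _ => ?_⟩
  rcases List.shortlex_nil_or_eq_nil (r := (· < ·)) (d.1 ++ d.2) with h | h
  · exact .inr (.inl h)
  · exact .inl (Prod.ext (List.append_eq_nil_iff.1 h).1 (List.append_eq_nil_iff.1 h).2)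

variable [Finite α]

theorem shortlex_wf : WellFounded (List.Shortlex (· < · : α → α → Prop)) :=
  List.Shortlex.wf wellFounded_lt

theorem exists_isMinWord {W : Set (List α)} (h : W.Nonempty) : ∃ u, IsMinWord W u := by
  obtain ⟨u, hu, hmin⟩ := shortlex_wf.has_min W h
  refine ⟨u, hu, fun v hv => ?_⟩
  by_cases h : List.Shortlex (· < ·) u v
  · exact .inr h
  · exact .inl (Std.Trichotomous.trichotomous (r := List.Shortlex (· < ·)) v u (hmin v hv) h)

/-- The order on contexts is the lexicographic product of two well-founded orders, pulled back along
`(x, z) ↦ (xz, x)`; this map is injective by cancellation. -/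
theorem exists_isMinContext {W : Set (List α × List α)} (h : W.Nonempty) :
    ∃ c, IsMinContext W c := by
  have hwf := InvImage.wf (fun c : List α × List α => (c.1 ++ c.2, c.1))
    (shortlex_wf.prod_lex shortlex_wf (α := List α))
  obtain ⟨c, hc, hmin⟩ := hwf.has_min W h
  refine ⟨c, hc, fun d hd => ?_⟩
  have hmin := hmin d hd
  simp only [InvImage, Prod.lex_def, not_or, not_and] at hmin
  by_cases h1 : List.Shortlex (· < ·) (c.1 ++ c.2) (d.1 ++ d.2)
  · exact .inr (.inl h1)
  have heq : d.1 ++ d.2 = c.1 ++ c.2 :=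
    Std.Trichotomous.trichotomous (r := List.Shortlex (· < ·)) _ _ hmin.1 h1
  by_cases h2 : List.Shortlex (· < ·) c.1 d.1
  · exact .inr (.inr ⟨heq.symm, h2⟩)
  have heq1 : d.1 = c.1 :=
    Std.Trichotomous.trichotomous (r := List.Shortlex (· < ·)) _ _ (hmin.2 heq) h2
  refine .inl (Prod.ext heq1 ?_)
  rw [heq1] at heq
  exact List.append_cancel_left heq

end Least

/-! ### Short contexts -/

section Contexts

variable {α : Type} {G : ContextFreeGrammar α}

/-- `B` has a rule whose right-hand side is `A` between two forms that derive words. -/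
def ProductiveChild (G : ContextFreeGrammar α) (B A : G.NT) : Prop :=
  ∃ ρ ∈ G.rules, ρ.input = B ∧ ∃ β₁ β₂ u v, ρ.output = β₁ ++ [.nonterminal A] ++ β₂ ∧
    Expands G β₁ u ∧ Expands G β₂ v

/-- Follows the ancestors of the displayed `A` back to a symbol of `β`. All symbols beside this line
derive words, because the final form is terminal except for `A`. -/
theorem exists_productiveChild_path {β : List (Symbol α G.NT)} {A : G.NT} {x z : List α}
    (h : G.Derives β (x.map .terminal ++ [.nonterminal A] ++ z.map .terminal)) :
    ∃ β₁ B β₂ u v, β = β₁ ++ [.nonterminal B] ++ β₂ ∧ Expands G β₁ u ∧ Expands G β₂ v ∧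
      Relation.ReflTransGen (ProductiveChild G) B A := by
  induction h using Relation.ReflTransGen.head_induction_on with
  | refl => exact ⟨_, A, _, x, z, rfl, expands_terminals x, expands_terminals z, .refl⟩
  | head hp _ ih =>
    obtain ⟨ρ, hρ, hr⟩ := hp
    obtain ⟨p, q, rfl, rfl⟩ := hr.exists_parts
    obtain ⟨β₁, B, β₂, u, v, heq, hu, hv, hBA⟩ := ih
    have hprod : ∀ {δ w}, Expands G (ρ.output ++ δ) w →
        ∃ w', Expands G (.nonterminal ρ.input :: δ) w' := fun h =>
      let ⟨_, _, h1, h2, _⟩ := h.exists_of_append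
      ⟨_, .nonterminal hρ h1 h2⟩
    simp only [List.append_assoc] at heq
    -- The ancestor `B` lies in `p`, in `ρ.output` or in `q`. In the middle case the path gains a
    -- step from `ρ.input`; otherwise `ρ.input` is one of the symbols beside it and derives a word
    -- through `ρ`.
    rcases List.append_eq_append_iff.1 heq with ⟨s, rfl, hs⟩ | ⟨s, rfl, hs⟩
    · rcases List.append_eq_append_iff.1 hs with ⟨s', rfl, hs'⟩ | ⟨s', hs', hs''⟩
      · obtain ⟨u₁, u₂, hu₁, hu₂, rfl⟩ := hu.exists_of_append
        obtain ⟨u₃, u₄, hu₃, hu₄, rfl⟩ := hu₂.exists_of_append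
        refine ⟨p ++ (.nonterminal ρ.input :: s'), B, β₂, _, v, ?_,
          hu₁.append (.nonterminal hρ hu₃ hu₄), hv, hBA⟩
        simp [hs']
      · cases s' with
        | nil =>
          obtain ⟨u₁, u₂, hu₁, hu₂, rfl⟩ := hu.exists_of_append
          refine ⟨p ++ [.nonterminal ρ.input], B, β₂, _, v, ?_, hu₁.append (.single hρ
            (u := u₂) ?_), hv, hBA⟩
          · simpa using hs''.symm
          · simpa [hs'] using hu₂
        | cons X s' =>
          obtain ⟨rfl, rfl⟩ : .nonterminal B = X ∧ β₂ = s' ++ q := by simpa using hs''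
          obtain ⟨u₁, u₂, hu₁, hu₂, rfl⟩ := hu.exists_of_append
          obtain ⟨v₁, v₂, hv₁, hv₂, rfl⟩ := hv.exists_of_append
          exact ⟨p, ρ.input, q, u₁, v₂, rfl, hu₁, hv₂, .head ⟨ρ, hρ, rfl, s, s', u₂, v₁,
            by simpa using hs', hu₂, hv₁⟩ hBA⟩
    · cases s with
      | nil =>
        simp only [List.nil_append] at hs hu
        cases hout : ρ.output with
        | nil =>
          rw [hout, List.nil_append] at hs
          refine ⟨β₁ ++ [.nonterminal ρ.input], B, β₂, _, v, by simp [← hs], hu.append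
            (.single hρ (u := []) ?_), hv, hBA⟩
          rw [hout]
          exact .nil
        | cons X δ =>
          rw [hout] at hs
          obtain ⟨rfl, rfl⟩ : .nonterminal B = X ∧ β₂ = δ ++ q := by simpa using hs
          obtain ⟨v₁, v₂, hv₁, hv₂, rfl⟩ := hv.exists_of_append
          exact ⟨β₁, ρ.input, q, u, v₂, by simp, hu, hv₂, .head ⟨ρ, hρ, rfl, [], δ, [], v₁,
            by simpa using hout, .nil, hv₁⟩ hBA⟩
      | cons X s =>
        obtain ⟨rfl, rfl⟩ : .nonterminal B = X ∧ β₂ = s ++ (ρ.output ++ q) := by simpa using hs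
        obtain ⟨v₁, v₂, hv₁, hv₂, rfl⟩ := hv.exists_of_append
        obtain ⟨v', hv'⟩ := hprod hv₂
        exact ⟨β₁, B, s ++ (.nonterminal ρ.input :: q), u, _, by simp, hu, hv₁.append hv', hBA⟩

/-- Cut the path at its last departure from `a`; what remains never leaves `a` again. -/
theorem reflTransGen_avoid {β : Type} [DecidableEq β] {P : β → β → Prop} {T : Finset β} {a b : β}
    (h : Relation.ReflTransGen (fun x y => x ∈ T ∧ P x y) a b) :
    a = b ∨ ∃ c, a ∈ T ∧ P a c ∧
      Relation.ReflTransGen (fun x y => x ∈ T.erase a ∧ P x y) c b := by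
  induction h with
  | refl => exact .inl rfl
  | @tail b b' _ hb ih =>
    refine .inr ?_
    by_cases hab : b = a
    · subst hab
      exact ⟨b', hb.1, hb.2, .refl⟩
    · rcases ih with rfl | ⟨c, ha, hc, hcb⟩
      · exact absurd rfl hab
      · exact ⟨c, ha, hc, hcb.tail ⟨Finset.mem_erase.2 ⟨hab, hb.1⟩, hb.2⟩⟩

/-- `B` derives `A` in a context of total length at most `N`. -/
def HasContext (G : ContextFreeGrammar α) (B A : G.NT) (N : ℕ) : Prop :=
  ∃ x z : List α, G.Derives [.nonterminal B]
    (x.map .terminal ++ [.nonterminal A] ++ z.map .terminal) ∧ x.length + z.length ≤ N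

theorem HasContext.trans {A B C : G.NT} {M N : ℕ} (h : HasContext G C B M)
    (h' : HasContext G B A N) : HasContext G C A (M + N) := by
  obtain ⟨x, z, hxz, hl⟩ := h
  obtain ⟨x', z', hxz', hl'⟩ := h'
  refine ⟨x ++ x', z' ++ z, ?_, by simp; omega⟩
  have := (hxz'.append_left (x.map .terminal)).append_right (z.map .terminal)
  simpa using hxz.trans this

/-- Each vertex of `T` needs to be left only once, so at most `T.card` steps remain, each adding at
most `τ` to the context. -/
theorem HasContext.of_reflTransGen {τ : ℕ}
    (hτ : ∀ B A, ProductiveChild G B A → HasContext G B A τ) (T : Finset G.NT) {B A : G.NT}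
    (h : Relation.ReflTransGen (fun x y => x ∈ T ∧ ProductiveChild G x y) B A) :
    HasContext G B A (T.card * τ) := by
  classical
  induction hn : T.card generalizing T B with
  | zero =>
    rcases reflTransGen_avoid h with rfl | ⟨c, hB, -⟩
    · exact ⟨[], [], by simpa using ContextFreeGrammar.Derives.refl _, by simp⟩
    · rw [Finset.card_eq_zero.1 hn] at hB
      simp at hB
  | succ n ih =>
    rcases reflTransGen_avoid h with rfl | ⟨c, hB, hc, hcA⟩
    · exact ⟨[], [], by simpa using ContextFreeGrammar.Derives.refl _, by simp⟩
    · have := (hτ _ _ hc).trans (ih (T.erase B) hcA (by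
        rw [Finset.card_erase_of_mem hB, hn, Nat.add_sub_cancel]))
      rwa [add_mul, one_mul, add_comm (n * τ)]

end Contexts

/-! ### The set `CS(G)` -/

section CharSet

variable {α : Type}

theorem exists_length_le_thickness {G : ContextFreeGrammar α} {ρ : ContextFreeRule α G.NT}
    (hρ : ρ ∈ G.rules) {w : List α} (hw : Expands G ρ.output w) :
    ∃ u, Expands G ρ.output u ∧ u.length ≤ thickness G := by
  have hne : (List.length '' yields G ρ.output).Nonempty := ⟨_, w, mem_yields.2 hw, rfl⟩
  obtain ⟨u, hu, hlen⟩ := Nat.sInf_mem hne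
  refine ⟨u, mem_yields.1 hu, ?_⟩
  rw [hlen]
  exact Finset.le_sup (f := fun ρ : ContextFreeRule α G.NT =>
    sInf (List.length '' yields G ρ.output)) hρ

/-- Right-hand sides with a nonterminal have at most two symbols, so `A` has at most one sibling,
and this derives a word no longer than the thickness. -/
theorem TypedNormalForm.hasContext {r : List α → List α → Prop} {G : ContextFreeGrammar α}
    (hG : TypedNormalForm r G) {B A : G.NT} (h : ProductiveChild G B A) :
    HasContext G B A (thickness G) := by
  obtain ⟨ρ, hρ, rfl, β₁, β₂, u, v, hout, hu, hv⟩ := h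
  have hprod : G.Derives [.nonterminal ρ.input] ρ.output :=
    Relation.ReflTransGen.single ⟨ρ, hρ, .input_output⟩
  have hshort : ∀ {D : G.NT} {w}, Expands G [.nonterminal D] w →
      ∃ w', Expands G [.nonterminal D] w' ∧ w'.length ≤ thickness G := by
    intro D w hw
    obtain ⟨σ, hσ, rfl, hout⟩ := hw.exists_rule
    obtain ⟨w', hw', hlen⟩ := exists_length_le_thickness hσ hout
    exact ⟨w', .single hσ hw', hlen⟩
  rw [hout] at hprod
  have hlenout := congrArg List.length hout
  simp only [List.length_append, List.length_singleton] at hlenout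
  obtain ⟨-, ⟨C, D, h⟩ | ⟨a, h⟩ | ⟨-, h | ⟨C, h⟩⟩⟩ := hG.1 ρ hρ
  · rw [h] at hout hlenout
    cases β₁ with
    | nil =>
      obtain ⟨-, rfl⟩ : C = A ∧ [.nonterminal D] = β₂ := by simpa using hout
      obtain ⟨w, hw, hlen⟩ := hshort hv
      exact ⟨[], w, hprod.trans (hw.derives.append_left _), by simpa using hlen⟩
    | cons X β₁ =>
      obtain ⟨rfl, h⟩ : .nonterminal C = X ∧ _ := by simpa using hout
      obtain ⟨rfl, rfl⟩ : β₁ = [] ∧ β₂ = [] := by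
        rw [← List.length_eq_zero_iff, ← List.length_eq_zero_iff]
        simp at hlenout
        omega
      obtain ⟨w, hw, hlen⟩ := hshort hu
      refine ⟨w, [], hprod.trans ?_, by simpa using hlen⟩
      simpa using hw.derives.append_right [.nonterminal A]
  · rw [h] at hout
    cases β₁ <;> simp at hout
  · rw [h] at hout
    cases β₁ <;> simp at hout
  · rw [h] at hlenout
    obtain ⟨rfl, rfl⟩ : β₁ = [] ∧ β₂ = [] := by
      rw [← List.length_eq_zero_iff, ← List.length_eq_zero_iff]
      simp at hlenout
      omega
    exact ⟨[], [], hprod, by simp⟩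

theorem TypedNormalForm.exists_short_context {r : List α → List α → Prop}
    {G : ContextFreeGrammar α} (hG : TypedNormalForm r G) {A : G.NT}
    (h : (contexts G A).Nonempty) :
    ∃ c ∈ contexts G A, c.1.length + c.2.length ≤ G.rules.card * thickness G := by
  classical
  obtain ⟨c, hc⟩ := h
  obtain ⟨β₁, B, β₂, u, v, heq, -, -, hBA⟩ := exists_productiveChild_path hc
  obtain rfl : B = G.initial := by
    cases β₁ <;> simp at heq
    exact heq.1.symm
  -- Only left-hand sides of rules have children, so the path leaves at most as many vertices as
  -- there are rules.
  have hpath : Relation.ReflTransGen (fun x y => x ∈ G.rules.image (·.input) ∧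
      ProductiveChild G x y) G.initial A :=
    Relation.ReflTransGen.mono (fun x y hxy => by
      refine ⟨?_, hxy⟩
      obtain ⟨ρ, hρ, rfl, -⟩ := hxy
      exact Finset.mem_image_of_mem _ hρ) _ _ hBA
  obtain ⟨x, z, hxz, hlen⟩ :=
    HasContext.of_reflTransGen (fun _ _ => hG.hasContext) _ hpath
  exact ⟨(x, z), hxz, hlen.trans (Nat.mul_le_mul_right _ Finset.card_image_le)⟩

/-- Only the start symbol can be rewritten to `λ`, and no right-hand side brings it back. -/
theorem TypedNormalForm.ne_nil {r : List α → List α → Prop} {G : ContextFreeGrammar α}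
    (hG : TypedNormalForm r G) {γ : List (Symbol α G.NT)} {w : List α} (h : Expands G γ w) :
    .nonterminal G.initial ∉ γ → γ ≠ [] → w ≠ [] := by
  induction h with
  | nil => exact fun _ h => absurd rfl h
  | terminal => simp
  | @nonterminal ρ hρ γ u v _ _ ihu _ =>
    intro hn _
    have hA : ρ.input ≠ G.initial := fun h => hn (by simp [h])
    have hu := ihu (hG.1 ρ hρ).1 (by
      obtain ⟨-, ⟨B, C, h⟩ | ⟨a, h⟩ | ⟨h, -⟩⟩ := hG.1 ρ hρ
      · simp [h]
      · simp [h]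
      · exact absurd h hA)
    simp [hu]

/-- Extend a context of the left-hand side by the words that the siblings of `B` derive. -/
theorem contexts_nonempty_of_rule {G : ContextFreeGrammar α} {ρ : ContextFreeRule α G.NT}
    (hρ : ρ ∈ G.rules) (hc : (contexts G ρ.input).Nonempty) {w : List α}
    (hw : Expands G ρ.output w) {B : G.NT} (hB : .nonterminal B ∈ ρ.output) :
    (contexts G B).Nonempty := by
  obtain ⟨c, hc⟩ := hc
  obtain ⟨β₁, β₂, hout⟩ := List.append_of_mem hB
  rw [hout] at hw
  obtain ⟨u, v, hu, hv, rfl⟩ := hw.exists_of_append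
  obtain ⟨-, v, -, hv, rfl⟩ := hv.exists_of_append (γ := [.nonterminal B])
  refine ⟨(c.1 ++ u, v ++ c.2), ?_⟩
  have h1 : G.Derives [.nonterminal ρ.input] ρ.output :=
    Relation.ReflTransGen.single ⟨ρ, hρ, .input_output⟩
  rw [hout] at h1
  have h2 := (hu.derives.append_right (.nonterminal B :: β₂)).trans
    ((hv.derives.append_left [.nonterminal B]).append_left (u.map .terminal))
  have h3 := ((h1.trans h2).append_left (c.1.map .terminal)).append_right (c.2.map .terminal)
  change G.Derives _ _
  simpa using ContextFreeGrammar.Derives.trans hc h3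

variable [LinearOrder α]

theorem length_le_of_mem_charSet {r : List α → List α → Prop} {G : ContextFreeGrammar α}
    (hG : TypedNormalForm r G) {w : List α} (hw : w ∈ charSet G) :
    w.length ≤ thickness G + G.rules.card * thickness G := by
  obtain ⟨ρ, hρ, u, c, hu, hc, rfl⟩ := hw
  obtain ⟨u', hu', h1⟩ := exists_length_le_thickness hρ (mem_yields.1 hu.1)
  obtain ⟨c', hc', h2⟩ := hG.exists_short_context ⟨c, hc.1⟩
  have h3 := hu.length_le (mem_yields.2 hu')
  have h4 := hc.length_le hc'
  simp
  omega

/-- Least words and least contexts are unique, so each rule contributes at most one word. -/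
theorem exists_finset_charSet (G : ContextFreeGrammar α) :
    ∃ S : Finset (List α), (S : Set (List α)) = charSet G ∧ S.card ≤ G.rules.card := by
  classical
  let P : ContextFreeRule α G.NT → List α → Prop := fun ρ w => ∃ u c,
    IsMinWord (yields G ρ.output) u ∧ IsMinContext (contexts G ρ.input) c ∧ w = c.1 ++ u ++ c.2
  have huniq : ∀ {ρ v w}, P ρ v → P ρ w → v = w := by
    rintro ρ v w ⟨u, c, hu, hc, rfl⟩ ⟨u', c', hu', hc', rfl⟩
    rw [hu.unique hu', hc.unique hc']
  refine ⟨(G.rules.filter fun ρ => ∃ w, P ρ w).image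
    (fun ρ => if h : ∃ w, P ρ w then h.choose else []), ?_,
    Finset.card_image_le.trans (Finset.card_filter_le _ _)⟩
  ext w
  simp only [Finset.coe_image, Set.mem_image, Finset.mem_coe, Finset.mem_filter]
  constructor
  · rintro ⟨ρ, ⟨hρ, h⟩, rfl⟩
    rw [dif_pos h]
    exact ⟨ρ, hρ, h.choose_spec⟩
  · rintro ⟨ρ, hρ, hw⟩
    have h : ∃ w, P ρ w := ⟨w, hw⟩
    refine ⟨ρ, ⟨hρ, h⟩, ?_⟩
    rw [dif_pos h]
    exact huniq h.choose_spec hw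

open Classical in
/-- The least word derived from `γ`; the empty word if there is none. -/
noncomputable def minWord (G : ContextFreeGrammar α) (γ : List (Symbol α G.NT)) : List α :=
  if h : ∃ u, IsMinWord (yields G γ) u then h.choose else []

/-- The symbol of `Ĝ(K)` for the least word derived from a symbol of `G`. -/
noncomputable def hatSymbol (G : ContextFreeGrammar α) :
    Symbol α G.NT → Symbol α (Option (List α))
  | .terminal a => .nonterminal (some [a])
  | .nonterminal A => .nonterminal (some (minWord G [.nonterminal A]))

theorem minWord_eq {G : ContextFreeGrammar α} {γ : List (Symbol α G.NT)} {u : List α}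
    (h : IsMinWord (yields G γ) u) : minWord G γ = u := by
  have h' : ∃ u, IsMinWord (yields G γ) u := ⟨u, h⟩
  rw [minWord, dif_pos h']
  exact h'.choose_spec.unique h

theorem minWord_letter (G : ContextFreeGrammar α) (a : α) : minWord G [.terminal a] = [a] := by
  refine minWord_eq ⟨mem_yields.2 (.terminal a .nil), fun v hv => .inl ?_⟩
  cases mem_yields.1 hv with
  | terminal _ h => cases h; rfl

theorem charSet_subset_language {G : ContextFreeGrammar α} {w : List α} (hw : w ∈ charSet G) :
    w ∈ G.language := by
  obtain ⟨ρ, hρ, u, c, hu, hc, rfl⟩ := hw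
  refine mem_language_iff_expands.2 (.of_derives hc.1 ?_)
  exact ((expands_terminals c.1).append (.single hρ (mem_yields.1 hu.1))).append
    (expands_terminals c.2)

variable [Finite α]

theorem isMinWord_minWord {G : ContextFreeGrammar α} {γ : List (Symbol α G.NT)} {w : List α}
    (h : Expands G γ w) : IsMinWord (yields G γ) (minWord G γ) := by
  obtain ⟨u, hu⟩ := exists_isMinWord (W := yields G γ) ⟨w, mem_yields.2 h⟩
  rwa [minWord_eq hu]

theorem expands_minWord {G : ContextFreeGrammar α} {γ : List (Symbol α G.NT)} {w : List α}
    (h : Expands G γ w) : Expands G γ (minWord G γ) :=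
  mem_yields.1 (isMinWord_minWord h).1

/-- The order is compatible with concatenation on both sides, so each part of the least word must
itself be least. Thus the sample word of a rule `A → BC` contains `ω(B)ω(C)`, ready to be branched.
-/
theorem minWord_append {G : ContextFreeGrammar α} {γ δ : List (Symbol α G.NT)} {w : List α}
    (h : Expands G (γ ++ δ) w) : minWord G (γ ++ δ) = minWord G γ ++ minWord G δ := by
  have hmin := isMinWord_minWord h
  obtain ⟨u, v, hu, hv, heq⟩ := (expands_minWord h).exists_of_append
  rw [heq] at hmin ⊢
  have h1 : minWord G γ = u := by
    rcases (isMinWord_minWord hu).2 u (mem_yields.2 hu) with h1 | h1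
    · exact h1.symm
    · have h1 := shortlex_append_right h1 v
      rcases hmin.2 _ (mem_yields.2 ((expands_minWord hu).append hv)) with h2 | h2
      · rw [h2] at h1
        exact absurd h1 (shortlex_irrefl _)
      · exact absurd h2 (shortlex_asymm h1)
  have h2 : minWord G δ = v := by
    rcases (isMinWord_minWord hv).2 v (mem_yields.2 hv) with h2 | h2
    · exact h2.symm
    · have h2 := h2.append_left u
      rcases hmin.2 _ (mem_yields.2 (hu.append (expands_minWord hv))) with h3 | h3
      · rw [h3] at h2
        exact absurd h2 (shortlex_irrefl _)
      · exact absurd h3 (shortlex_asymm h2)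
  rw [h1, h2]

/-- The least word of `A` is the least word of the right-hand side that begins its derivation. Hence
`ω(A)` itself, in the least context of `A`, belongs to `CS(G)`. -/
theorem exists_rule_minWord {G : ContextFreeGrammar α} {A : G.NT} {w : List α}
    (h : Expands G [.nonterminal A] w) : ∃ ρ ∈ G.rules, ρ.input = A ∧
      Expands G ρ.output (minWord G [.nonterminal A]) ∧
        minWord G ρ.output = minWord G [.nonterminal A] := by
  have hmin := isMinWord_minWord h
  obtain ⟨ρ, hρ, rfl, hexp⟩ := (expands_minWord h).exists_rule
  exact ⟨ρ, hρ, rfl, hexp, minWord_eq ⟨mem_yields.2 hexp, fun v hv =>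
    hmin.2 v (mem_yields.2 (.single hρ (mem_yields.1 hv)))⟩⟩

variable [Fintype α]

/-- A rule `A → β` with `A ≠ S` is simulated by `[ω(A)] → [ω(β)]`, followed by splitting `ω(β)`
along `β`. The unit rule exists because both words occur in `K` in the least context of `A` and are
equivalent by typing. -/
theorem TypedNormalForm.isCharacteristic {r : List α → List α → Prop} {G : ContextFreeGrammar α}
    (hG : TypedNormalForm r G) (hsub : Substitutable r G.language) {S : Finset (List α)}
    (hS : (S : Set (List α)) = charSet G) : IsCharacteristic (hatGrammar r) S G.language := by
  have memS : ∀ {w}, w ∈ S ↔ w ∈ charSet G := fun {w} => by rw [← hS]; rfl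
  refine ⟨fun w hw => charSet_subset_language (memS.1 hw), fun K hSK hKL => ?_⟩
  have memK : ∀ {ρ}, ρ ∈ G.rules → ∀ {c}, IsMinContext (contexts G ρ.input) c →
      ∀ {w}, Expands G ρ.output w → c.1 ++ minWord G ρ.output ++ c.2 ∈ K :=
    fun hρ _ hc _ hw => hSK (memS.2 ⟨_, hρ, _, _, isMinWord_minWord hw, hc, rfl⟩)
  have toOutput : ∀ {ρ}, ρ ∈ G.rules → ρ.input ≠ G.initial → (contexts G ρ.input).Nonempty →
      ∀ {w}, Expands G ρ.output w → HatDerives r K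
        [.nonterminal (some (minWord G [.nonterminal ρ.input]))]
        [.nonterminal (some (minWord G ρ.output))] := by
    intro ρ hρ hne hctx w hw
    obtain ⟨c, hc⟩ := exists_isMinContext hctx
    have hA := Expands.single hρ hw
    have hA' := expands_minWord hA
    have hout := Expands.single hρ (expands_minWord hw)
    have hn : Symbol.nonterminal G.initial ∉ [Symbol.nonterminal (T := α) ρ.input] := by
      simpa using hne.symm
    -- The rule `σ` has left-hand side `A` and `ω(A)` as least word of its right-hand side, so its
    -- sample word puts `ω(A)` into the least context of `A`.
    obtain ⟨σ, hσ, hσi, hσe, hσm⟩ := exists_rule_minWord hA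
    have k := memK hσ (by rwa [hσi]) hσe
    rw [hσm] at k
    exact HatDerives.unit (hG.ne_nil hA' hn (by simp)) (hG.ne_nil hout hn (by simp))
      (hG.2 _ hne _ (mem_yields.2 hA') _ (mem_yields.2 hout)) k (memK hρ hc hw)
  have expand : ∀ {ρ}, ρ ∈ G.rules → ρ.output ≠ [] → (contexts G ρ.input).Nonempty →
      ∀ {w}, Expands G ρ.output w → HatDerives r K
        [.nonterminal (some (minWord G ρ.output))] (ρ.output.map (hatSymbol G)) := by
    intro ρ hρ hne hctx w hw
    obtain ⟨c, hc⟩ := exists_isMinContext hctx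
    have k := memK hρ hc hw
    obtain ⟨hn, ⟨B, C, h⟩ | ⟨a, h⟩ | ⟨-, h | ⟨B, h⟩⟩⟩ := hG.1 ρ hρ
    · have hout : ρ.output = [.nonterminal B] ++ [.nonterminal C] := h
      rw [hout] at hw k hn ⊢
      rw [minWord_append hw] at k ⊢
      obtain ⟨u, v, hu, hv, rfl⟩ := hw.exists_of_append
      simp only [List.mem_append, not_or] at hn
      exact HatDerives.branch (hG.ne_nil (expands_minWord hu) hn.1 (by simp))
        (hG.ne_nil (expands_minWord hv) hn.2 (by simp)) k
    -- A right-hand side of one symbol is already represented by the bracket of its least word, so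
    -- no step is needed.
    · rw [h, minWord_letter]
      exact .refl _
    · exact absurd h hne
    · rw [h]
      exact .refl _
  have complete : ∀ {γ w}, Expands G γ w → (∀ a, .terminal a ∈ γ → [a] ∈ factors K) →
      (∀ A, .nonterminal A ∈ γ → A ≠ G.initial ∧ (contexts G A).Nonempty) →
      HatDerives r K (γ.map (hatSymbol G)) (w.map .terminal) := by
    intro γ w h
    induction h with
    | nil => exact fun _ _ => .refl _
    | @terminal a γ v _ ih =>
      intro ht hn
      exact HatDerives.append (β := [_]) (.letter (ht a (by simp)))
        (ih (fun b hb => ht b (by simp [hb])) fun A hA => hn A (by simp [hA]))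
    | @nonterminal ρ hρ γ u v hu _ ihu ihv =>
      intro ht hn
      obtain ⟨hne, hctx⟩ := hn ρ.input (by simp)
      rw [List.map_append]
      refine HatDerives.append (β := [_]) ?_
        (ihv (fun b hb => ht b (by simp [hb])) fun A hA => hn A (by simp [hA]))
      have hnil : ρ.output ≠ [] := fun h => by
        rw [h] at hu
        cases hu
        refine hG.ne_nil (γ := [.nonterminal ρ.input]) (w := []) (.single hρ (by rw [h]; exact .nil))
          ?_ (by simp) rfl
        simpa using hne.symm
      refine ((toOutput hρ hne hctx hu).trans (expand hρ hnil hctx hu)).trans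
        (ihu (fun a ha => ?_) fun B hB => ⟨?_, contexts_nonempty_of_rule hρ hctx hu hB⟩)
      · obtain ⟨c, hc⟩ := exists_isMinContext hctx
        have k := memK hρ hc hu
        have hout : ρ.output = [.terminal a] := by
          obtain ⟨-, ⟨B, C, h⟩ | ⟨b, h⟩ | ⟨-, h | ⟨B, h⟩⟩⟩ := hG.1 ρ hρ <;> simp_all
        rw [hout, minWord_letter] at k
        exact (mem_factors K _).2 ⟨by simp, c.1, c.2, k⟩
      · rintro rfl
        exact (hG.1 ρ hρ).1 hB
  refine Set.Subset.antisymm (fun w hw => hsub.hatGrammar_sound hKL hw) fun w hw => ?_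
  obtain ⟨ρ, hρ, hin, hw⟩ := (mem_language_iff_expands.1 hw).exists_rule
  -- The least context of `S` is empty, so `ω(β) ∈ K` for every productive rule `S → β`, and `Ŝ →
  -- [ω(β)]` replaces the unit step. No equivalence between the words of `S` is required.
  have hmin : IsMinContext (contexts G ρ.input) ([], []) := isMinContext_nil <| by
    rw [hin]
    change G.Derives _ _
    exact ContextFreeGrammar.Derives.refl _
  have k := memK hρ hmin hw
  simp only [List.nil_append, List.append_nil] at k
  by_cases hnil : ρ.output = []
  · have hw0 := expands_minWord hw
    rw [hnil] at hw hw0 k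
    cases hw
    generalize minWord G [] = x at hw0 k
    cases hw0
    exact subset_hatGrammar_language k
  · have hs := HatDerives.start (r := r) k
    rw [bracket_of_ne_nil (hG.ne_nil (expands_minWord hw) (hG.1 ρ hρ).1 hnil)] at hs
    refine (hs.trans (expand hρ hnil ⟨_, hmin.1⟩ hw)).trans (complete hw (fun a ha => ?_)
      fun B hB => ⟨?_, contexts_nonempty_of_rule hρ ⟨_, hmin.1⟩ hw hB⟩)
    · have hout : ρ.output = [.terminal a] := by
        obtain ⟨-, ⟨B, C, h⟩ | ⟨b, h⟩ | ⟨-, h | ⟨B, h⟩⟩⟩ := hG.1 ρ hρ <;> simp_all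
      rw [hout, minWord_letter] at k
      exact (mem_factors K _).2 ⟨by simp, [], [], by simpa using k⟩
    · rintro rfl
      exact (hG.1 ρ hρ).1 hB

theorem exists_polynomial_charSet (r : List α → List α → Prop) :
    ∃ q : Polynomial ℕ, ∀ G : ContextFreeGrammar α, TypedNormalForm r G →
      G.language ∈ substClass r → ∃ S : Finset (List α), (S : Set (List α)) = charSet G ∧
        S.card ≤ G.rules.card ∧
        ∑ w ∈ S, w.length ≤ q.eval (grammarSize G + thickness G) ∧
        IsCharacteristic (hatGrammar r) S G.language := by
  -- There are at most `|G|` words, each of length at most `τ + |rules| * τ`.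
  refine ⟨.X * (.X + .X * .X), fun G hG hL => ?_⟩
  obtain ⟨S, hS, hcard⟩ := exists_finset_charSet G
  refine ⟨S, hS, hcard, ?_, hG.isCharacteristic hL.2 hS⟩
  have h1 : ∑ w ∈ S, w.length ≤ S.card • (thickness G + G.rules.card * thickness G) :=
    Finset.sum_le_card_nsmul _ _ _ fun w hw => length_le_of_mem_charSet hG (by
      rw [← hS]
      exact hw)
  have h2 : G.rules.card ≤ grammarSize G := by
    rw [Finset.card_eq_sum_ones]
    exact Finset.sum_le_sum fun ρ _ => by omega
  rw [smul_eq_mul] at h1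
  refine h1.trans ?_
  simp only [Polynomial.eval_mul, Polynomial.eval_add, Polynomial.eval_X]
  gcongr <;> omega

end CharSet

end SubstLearn

/-! ### Assembly of the two parts. -/

theorem mainTheorem4 {α : Type} [Fintype α] [LinearOrder α] :
    (∀ r : List α → List α → Prop, SubstLearn.PolyTimeDecidable r →
      SubstLearn.PolyTimeLearner (SubstLearn.hatGrammar r)) ∧
    (∀ r : List α → List α → Prop, Equivalence r → SubstLearn.Recognizable r →
      SubstLearn.LearnsFromPolyTimeAndData (SubstLearn.hatGrammar r) (SubstLearn.substClass r) ∧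
      SubstLearn.IdentifiesInLimit
        (fun w n => SubstLearn.hatGrammar r ((Finset.range n).image w))
        (SubstLearn.substClass r) ∧
      SubstLearn.IdentifiesInLimit
        (fun w n => SubstLearn.hatGrammar r (SubstLearn.conservativeSample r w n))
        (SubstLearn.substClass r) ∧
      ∃ q : Polynomial ℕ, ∀ G : ContextFreeGrammar α, SubstLearn.TypedNormalForm r G →
        G.language ∈ SubstLearn.substClass r →
        ∃ S : Finset (List α), (S : Set (List α)) = SubstLearn.charSet G ∧
          S.card ≤ G.rules.card ∧
          ∑ w ∈ S, w.length ≤ q.eval (SubstLearn.grammarSize G + SubstLearn.thickness G) ∧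
          SubstLearn.IsCharacteristic (SubstLearn.hatGrammar r) S G.language) := by
  refine ⟨fun r hr => SubstLearn.polyTimeLearner_hatGrammar hr.polyTime (by simp),
    fun r heq hrec => ?_⟩
  obtain ⟨q, hq⟩ := SubstLearn.exists_polynomial_isCharacteristic heq.refl hrec
  have hchar : ∀ L ∈ SubstLearn.substClass r,
      ∃ S, SubstLearn.IsCharacteristic (SubstLearn.hatGrammar r) S L := by
    rintro L hL
    obtain ⟨G, rfl⟩ := hL.1
    obtain ⟨S, -, hS⟩ := hq G hL
    exact ⟨S, hS⟩
  exact ⟨⟨SubstLearn.polyTimeLearner_hatGrammar hrec.polyTime (by simp), q, hq⟩,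
    SubstLearn.identifiesInLimit_image hchar,
    SubstLearn.identifiesInLimit_conservativeSample fun L hL => ⟨hL.2, hchar L hL⟩,
    SubstLearn.exists_polynomial_charSet r⟩
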